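/- **Setting.** Let $\mathcal X\subseteq\mathbb R^p$ be measurable and let $p_\theta(x)=c(x)e^{\theta\cdot\phi(x)-\Lambda(\theta)}$, $x\in\mathcal X$, be an exponential family with carrier density $c\ge 0$, $0<\int_{\mathcal X} c\,dx<\infty$, measurable sufficient statistic $\phi:\mathcal X\to\mathbb R^d$, cumulant generating function $\Lambda(\theta)=\log\int_{\mathcal X} c(x)e^{\theta\cdot\phi(x)}dx$, mean $\mu(\theta)=\mathbb E_\theta\phi(X)$ and covariance matrix $\Sigma(\theta)=\mathrm{Cov}_\theta\,\phi(X)$. Let $\Theta\subseteq\mathbb R^d$ and, for $\theta\in\Theta$, let $k_\theta(x,dy)$ be a Markov transition kernel on $\mathcal X$ with equilibrium distribution $p_\theta$ (jointly measurable in $(\theta,x)$), with $m$-step kernel $k^m_\theta$ and Markov operator $K_\theta f(x)=\int f(y)\,k_\theta(x,dy)$. Let $\alpha(\theta)$ be the second largest absolute eigenvalue of $K_\theta$ on $L^2(p_\theta)$, that is, the spectral radius of $K_\theta$ on the mean-zero functions of $L^2(p_\theta)$. Assume: * (A1) $\phi(x)\in[-C,C]^d$ for all $x\in\mathcal X$.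 * (A2) $\Theta$ is convex and compact, and $\theta^*$ is an interior point of $\Theta$. * (A3) $\Sigma(\theta)$ is positive definite for every $\theta\in\Theta$. Let $\lambda_{\min}$ be the infimum over $\Theta$ of the smallest eigenvalue of $\Sigma(\theta)$, and $\lambda_{\max}$ the supremum over $\Theta$ of the largest one. * (A4) There is $\zeta$ such that $\sup_{|f|\le1}\sup_{x}|(K_\theta f)(x)-(K_{\theta'}f)(x)|\le\zeta\|\theta-\theta'\|$ for all $\theta,\theta'\in\Theta$. * (A5) $\alpha:=\sup_{\theta\in\Theta}\alpha(\theta)<1$. * (A6) $\phi(\mathcal X)$ is convex; for $Y\sim k_\theta(x,\cdot)$ the vector $\phi(Y)$ has a density $p(\cdot\mid\theta,x)$ on $\mathbb R^d$, and $\inf_{\theta\in\Theta}\inf_{v\in\phi(\mathcal X)}p(v\mid\theta,x)>0$ for every $x\in\mathcal X$. Let $L$ be a Lipschitz constant on $\Theta$ of $\theta\mapsto\sqrt{e^{-2\Lambda(\theta^*)+\Lambda(\theta)+\Lambda(2\theta^*-\theta)}-1}$, and let $0<\gamma_1<1/2$. For $m\ge1$ and a learning rate $\eta>0$ put $$a=\lambda_{\min}^2-\sqrt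 d\,CL\alpha^m\lambda_{\max}-\tfrac{\eta\lambda_{\max}}2\bigl(\lambda_{\max}+\sqrt d\,CL\alpha^m\bigr)^2 ,$$ $$b_n=\lambda_{\max}(1+\sqrt d\,CL\alpha^m)(1+\eta\lambda_{\max}+\eta\sqrt d\,CL\alpha^m)\,n^{-1/2+\gamma_1},$$ $$c_n=\tfrac{\eta\lambda_{\max}}2\bigl[dC^2n^{-2\gamma_1}+(1+\sqrt d\,CL\alpha^m)^2\bigr]n^{-1+2\gamma_1},\qquad r_n=\frac{b_n+\sqrt{b_n^2+4ac_n}}{2a}.$$ **Data.** A sample $\mathbf x=(x_1,\dots,x_n)\in\mathcal X^n$ with maximum likelihood estimate $\hat\theta_n\in\Theta$ (a maximizer over $\Theta$ of the log-likelihood) is *admissible* for $m$ if $$\Bigl\|\tfrac1n\sum_i\phi(x_i)-\mu(\theta^*)\Bigr\|<n^{-1/2+\gamma_1},\qquad \|\hat\theta_n-\theta^*\|<n^{-1/2+\gamma_1},$$ $$\sup_{\theta\in\Theta}\Bigl\|\tfrac1n\sum_i\int\phi(y)\,k_\theta^m(x_i,dy)-\int\phi(y)\,(k_\theta^mp_{\theta^*})(dy)\Bigr\|<n^{-1/2+\gamma_1}.$$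 **Chain.** Given $\mathbf x$, the CD chain $\{\theta_t\}$ is the Markov chain on $\Theta$ that moves from $\theta$ to $$\theta+\eta\Bigl[\tfrac1n\sum_i\phi(x_i)-\tfrac1n\sum_i\phi(X_i^{(m)})\Bigr],\qquad X_i^{(m)}\sim k_\theta^m(x_i,\cdot)\ \text{independent},$$ whenever this point lies in $\Theta$; if it does not, the chain moves to a point of $\Theta$ given by a measurable function of $\theta$ and of the proposed point. This function is arbitrary (for example: projection on $\Theta$, or staying at $\theta$); the result below holds for each choice of it. **Definitions.** For a Markov chain $\{Z_t\}$ with transition kernel $P$ and a measurable set $B$ of states, let $T=\min\{t\ge1:Z_t\in B\}$. The set $B$ is *recurrent* if $\mathbb P_z(T<\infty)=1$ for every state $z$, and *positive recurrent* if moreover $\mathbb E_zT<\infty$ for every state $z$ and $\sup_{z\in B}\mathbb E_zT<\infty$. It is *small* if it is accessible ($\mathbb P_z(T<\infty)>0$ for every $z$) and $P(z,\cdot)\ge\varepsilon\,\mathbf 1_B(z)\,q(\cdot)$ for some $\varepsilon>0$ and some probability measure $q$. The chain is *positive Harris recurrent* if there is a set that is both positive recurrent and small. **Statement.** Let $B_\beta=\{\theta\in\Theta:\|\theta-\hat\theta_n\|\le\beta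 r_n\}$. 1. There is $N$ such that for all $n\ge N$, all $m\ge1$ and $\eta>0$ with $a>0$, and every admissible sample $\mathbf x$ of size $n$, the CD chain $\{\theta_t\}$ is positive Harris recurrent, and $B_\beta$ is positive recurrent for every $\beta>1$. 2. For all $m\ge1$, $\eta>0$ with $a>0$ and all $\beta>1$ there is $N$ such that for all $n\ge N$ and every admissible sample $\mathbf x$ of size $n$, the ball $B_\beta$ is a small set of the CD chain. -/

import Mathlib

open MeasureTheory ProbabilityTheory Set
open scoped NNReal ENNReal RealInnerProductSpace

noncomputable section

/-! ### Markov chains on a general state space -/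

namespace MarkovChain

variable {S : Type*} [MeasurableSpace S]

/-- The law on path space of the homogeneous Markov chain `Z_0, Z_1, …` with transition kernel `P`
started at `Z_0 = z`. -/
def pathLaw (P : Kernel S S) [IsMarkovKernel P] (z : S) : Measure (ℕ → S) :=
  Kernel.trajMeasure (X := fun _ => S) (Measure.dirac z)
    (fun t => P.comap (fun h => h ⟨t, Finset.mem_Iic.2 le_rfl⟩) (measurable_pi_apply _))

/-- `T = min {t ≥ 1 : Z_t ∈ B}`, equal to `⊤` if the path never visits `B` at a time `t ≥ 1`. -/
def hitTime (B : Set S) (Z : ℕ → S) : ℕ∞ := ⨅ t ∈ {t : ℕ | 1 ≤ t ∧ Z t ∈ B}, (t : ℕ∞)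

/-- The expected hitting (or return) time `E_z T`, with values in `[0, ∞]`. -/
def expHitTime (P : Kernel S S) [IsMarkovKernel P] (B : Set S) (z : S) : ℝ≥0∞ :=
  ∫⁻ Z, ((hitTime B Z : ℕ∞) : ℝ≥0∞) ∂(pathLaw P z)

/-- `B` is recurrent: from every starting point the chain (re)visits `B` almost surely. -/
def IsRecurrentSet (P : Kernel S S) [IsMarkovKernel P] (B : Set S) : Prop :=
  MeasurableSet B ∧ ∀ z, ∀ᵐ Z ∂(pathLaw P z), hitTime B Z < ⊤

/-- `B` is positive recurrent: it is recurrent, the expected hitting time of `B` is finite from every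
starting point, and the expected return time is bounded uniformly over `B`. -/
def IsPositiveRecurrentSet (P : Kernel S S) [IsMarkovKernel P] (B : Set S) : Prop :=
  IsRecurrentSet P B ∧ (∀ z, expHitTime P B z < ⊤) ∧ (⨆ z ∈ B, expHitTime P B z) < ⊤

/-- `B` is accessible: from every starting point it is visited with positive probability. -/
def IsAccessibleSet (P : Kernel S S) [IsMarkovKernel P] (B : Set S) : Prop :=
  MeasurableSet B ∧ ∀ z, 0 < pathLaw P z {Z | hitTime B Z < ⊤}

/-- `B` is small: it is accessible and `P_z(Z_1 ∈ ·) ≥ ε 1_B(z) q(·)` for some `ε > 0` and some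
probability measure `q`. -/
def IsSmallSet (P : Kernel S S) [IsMarkovKernel P] (B : Set S) : Prop :=
  IsAccessibleSet P B ∧ ∃ (ε : ℝ≥0) (q : Measure S), 0 < ε ∧ IsProbabilityMeasure q ∧
    ∀ z ∈ B, ∀ A, MeasurableSet A → ε * q A ≤ P z A

/-- A positive Harris recurrent chain: some set is both positive recurrent and small. -/
def IsPositiveHarrisRecurrent (P : Kernel S S) [IsMarkovKernel P] : Prop :=
  ∃ B : Set S, IsPositiveRecurrentSet P B ∧ IsSmallSet P B

/-- The norm of the Markov operator `(Q f)(x) = ∫ f(y) Q(x, dy)` on the mean-zero functions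
in `L²(μ)`. -/
def l2ZeroNorm (Q : Kernel S S) (μ : Measure S) : ℝ≥0∞ :=
  ⨆ f ∈ {f : S → ℝ | MemLp f 2 μ ∧ ∫ x, f x ∂μ = 0 ∧ eLpNorm f 2 μ ≤ 1},
    eLpNorm (fun x => ∫ y, f y ∂(Q x)) 2 μ

end MarkovChain

/-! ### Exponential families with MCMC kernels -/

namespace ContrastiveDivergence

/-- Lebesgue measure on `X ⊆ ℝ^p`. -/
def leb {p : ℕ} (X : Set (EuclideanSpace ℝ (Fin p))) : Measure X :=
  (volume : Measure (EuclideanSpace ℝ (Fin p))).comap Subtype.val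

/-- The exponential family distribution `p_θ(x) dx = c(x) exp (θ · φ(x) - Λ(θ)) dx` on `X`. -/
def expFamily {p d : ℕ} {X : Set (EuclideanSpace ℝ (Fin p))} (c : X → ℝ≥0)
    (φ : X → EuclideanSpace ℝ (Fin d)) (θ : EuclideanSpace ℝ (Fin d)) : Measure X :=
  ((leb X).withDensity (fun x => (c x : ℝ≥0∞))).tilted (fun x => ⟪θ, φ x⟫)

/-- An exponential family on `X ⊆ ℝ^p` with carrier density `c`, sufficient statistic
`φ : X → ℝ^d` and parameter set `Θ ⊆ ℝ^d`, together with a family of Markov kernels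
`k_θ` on `X`, `θ ∈ Θ`, having `p_θ` as equilibrium distributions. -/
structure Model (p d : ℕ) where
  X : Set (EuclideanSpace ℝ (Fin p))
  measurableSet_X : MeasurableSet X
  c : X → ℝ≥0
  measurable_c : Measurable c
  φ : X → EuclideanSpace ℝ (Fin d)
  measurable_φ : Measurable φ
  Θ : Set (EuclideanSpace ℝ (Fin d))
  /-- the carrier has positive and finite total mass -/
  carrier_ne_zero : ∫⁻ x, c x ∂(leb X) ≠ 0
  carrier_ne_top : ∫⁻ x, c x ∂(leb X) ≠ ⊤
  /-- `k (θ, x)` is the distribution `k_θ(x, dy)` -/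
  k : Kernel (Θ × X) X
  isMarkovKernel_k : IsMarkovKernel k
  invariant_k : ∀ θ : Θ, (k.sectR θ).Invariant (expFamily c φ θ)

namespace Model

variable {p d : ℕ} (M : Model p d)

instance : IsMarkovKernel M.k := M.isMarkovKernel_k

/-- The distribution `p_θ(x) dx`. -/
def P (θ : EuclideanSpace ℝ (Fin d)) : Measure M.X := expFamily M.c M.φ θ

/-- The cumulant generating function `Λ(θ) = log ∫ c(x) exp (θ · φ(x)) dx`. -/
def Λ (θ : EuclideanSpace ℝ (Fin d)) : ℝ :=
  Real.log (∫ x, (M.c x : ℝ) * Real.exp ⟪θ, M.φ x⟫ ∂(leb M.X))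

/-- `μ(θ) = E_θ φ(X)`. -/
def mu (θ : EuclideanSpace ℝ (Fin d)) : EuclideanSpace ℝ (Fin d) := ∫ x, M.φ x ∂(M.P θ)

/-- `Σ(θ) = Cov_θ φ(X)`. -/
def Sig (θ : EuclideanSpace ℝ (Fin d)) : Matrix (Fin d) (Fin d) ℝ :=
  Matrix.of fun i j => cov[fun x => M.φ x i, fun x => M.φ x j; M.P θ]

/-- The infimum over `Θ` of the smallest eigenvalue of `Σ(θ)`. -/
def lamMin : ℝ := ⨅ θ : M.Θ, sInf (spectrum ℝ (M.Sig θ))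

/-- The supremum over `Θ` of the largest eigenvalue of `Σ(θ)`. -/
def lamMax : ℝ := ⨆ θ : M.Θ, sSup (spectrum ℝ (M.Sig θ))

/-- The `m`-step kernels `k_θ^m(x, dy)`, jointly in `(θ, x)`. -/
def kPow : ℕ → Kernel (M.Θ × M.X) M.X
  | 0 => Kernel.deterministic Prod.snd measurable_snd
  | m + 1 => M.k ∘ₖ (Kernel.deterministic Prod.fst measurable_fst ×ₖ kPow m)

instance isMarkovKernel_kPow (m : ℕ) : IsMarkovKernel (M.kPow m) := by
  induction m with
  | zero => exact inferInstanceAs (IsMarkovKernel (Kernel.deterministic _ _))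
  | succ m ih => exact inferInstanceAs (IsMarkovKernel (M.k ∘ₖ _))

/-- The second largest absolute eigenvalue `α(θ)` of the Markov operator `K_θ` on `L²(p_θ)`: the
spectral radius `inf_j ‖K_θ^j‖^(1/j)` of `K_θ` on the mean-zero functions. For a reversible kernel
this is the norm of `K_θ` on the mean-zero functions. -/
def alphaAt (θ : M.Θ) : ℝ≥0∞ :=
  ⨅ j : ℕ, MarkovChain.l2ZeroNorm ((M.kPow (j + 1)).sectR θ) (M.P θ) ^ (1 / ((j : ℝ) + 1))

/-- `α = sup_Θ α(θ)`. -/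
def alphaSup : ℝ≥0∞ := ⨆ θ : M.Θ, M.alphaAt θ

/-- `α` as a real number. -/
def alpha : ℝ := M.alphaSup.toReal

/-! #### The assumptions -/

/-- `φ(X) ⊆ [-C, C]^d`. -/
def A1 (C : ℝ) : Prop := ∀ x j, |M.φ x j| ≤ C

/-- `Θ` is convex and compact and `θ*` is an interior point. -/
def A2 (θs : EuclideanSpace ℝ (Fin d)) : Prop := Convex ℝ M.Θ ∧ IsCompact M.Θ ∧ θs ∈ interior M.Θ

/-- `Σ(θ)` is positive definite on `Θ`. -/
def A3 : Prop := ∀ θ ∈ M.Θ, (M.Sig θ).PosDef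

/-- `K_θ` is Lipschitz in `θ` for the metric
`ρ(K, K') = sup_{|f| ≤ 1} sup_x |(K f)(x) - (K' f)(x)|`. -/
def A4 : Prop := ∃ ζ : ℝ, ∀ (θ θ' : M.Θ) (f : M.X → ℝ), Measurable f → (∀ x, |f x| ≤ 1) →
  ∀ x, |∫ y, f y ∂(M.k (θ, x)) - ∫ y, f y ∂(M.k (θ', x))| ≤ ζ * ‖(θ : EuclideanSpace ℝ (Fin d)) - θ'‖

/-- The `L²`-spectral gaps `1 - α(θ)` are bounded away from `0` on `Θ`. -/
def A5 : Prop := M.alphaSup < 1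

/-- `φ(X)` is convex; for `Y ∼ k_θ(x, ·)` the vector `φ(Y)` has a density `ρ(· | θ, x)`, and for every
`x` this density is bounded away from `0` on `φ(X)`, uniformly in `θ ∈ Θ`. -/
def A6 : Prop := Convex ℝ (range M.φ) ∧
  ∃ ρ : M.Θ → M.X → EuclideanSpace ℝ (Fin d) → ℝ≥0∞,
    (∀ θ x, Measurable (ρ θ x)) ∧
    (∀ θ x, (M.k (θ, x)).map M.φ = volume.withDensity (ρ θ x)) ∧
    ∀ x, 0 < ⨅ θ : M.Θ, ⨅ v ∈ range M.φ, ρ θ x v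

/-! #### Data, constants and the contrastive divergence chain -/

/-- The empirical mean of the sufficient statistic. -/
def meanφ {n : ℕ} (x : Fin n → M.X) : EuclideanSpace ℝ (Fin d) :=
  (n : ℝ)⁻¹ • ∑ i, M.φ (x i)

/-- The log-likelihood `l(θ)`. -/
def logLik {n : ℕ} (x : Fin n → M.X) (θ : EuclideanSpace ℝ (Fin d)) : ℝ :=
  (n : ℝ)⁻¹ * ∑ i, Real.log (M.c (x i)) + ⟪θ, M.meanφ x⟫ - M.Λ θ

/-- `θh` is a maximum likelihood estimate in `Θ`. -/
def IsMLE {n : ℕ} (x : Fin n → M.X) (θh : EuclideanSpace ℝ (Fin d)) : Prop :=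
  θh ∈ M.Θ ∧ IsMaxOn (M.logLik x) M.Θ θh

/-- The three constraints on the data `x`, with true parameter `θs`, MLE `θh`, and `m` MCMC steps. -/
def DataOK {n : ℕ} (γ : ℝ) (m : ℕ) (θs θh : EuclideanSpace ℝ (Fin d)) (x : Fin n → M.X) : Prop :=
  ‖M.meanφ x - M.mu θs‖ < (n : ℝ) ^ (-(1 / 2) + γ) ∧
  ‖θh - θs‖ < (n : ℝ) ^ (-(1 / 2) + γ) ∧
  (⨆ θ : M.Θ, ‖(n : ℝ)⁻¹ • ∑ i, ∫ y, M.φ y ∂(M.kPow m (θ, x i)) -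
      ∫ y, M.φ y ∂((M.P θs).bind ((M.kPow m).sectR θ))‖) < (n : ℝ) ^ (-(1 / 2) + γ)

/-- The function `θ ↦ √(exp (-2 Λ(θ*) + Λ(θ) + Λ(2 θ* - θ)) - 1)`, the `χ²`-discrepancy
`(∫ (p_{θ*} / p_θ - 1)² p_θ dx)^(1/2)`. -/
def chi (θs θ : EuclideanSpace ℝ (Fin d)) : ℝ :=
  √(Real.exp (-2 * M.Λ θs + M.Λ θ + M.Λ ((2 : ℝ) • θs - θ)) - 1)

/-- `√d C L α^m`. -/
def biasCoef (C L : ℝ) (m : ℕ) : ℝ := √(d : ℝ) * C * L * M.alpha ^ m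

/-- `a = λ_min² - √d C L α^m λ_max - (η λ_max / 2) (λ_max + √d C L α^m)²`. -/
def aConst (C L : ℝ) (m : ℕ) (η : ℝ) : ℝ :=
  M.lamMin ^ 2 - M.biasCoef C L m * M.lamMax
    - η * M.lamMax / 2 * (M.lamMax + M.biasCoef C L m) ^ 2

/-- `b_n`. -/
def bConst (C L γ : ℝ) (m : ℕ) (η : ℝ) (n : ℕ) : ℝ :=
  M.lamMax * (1 + M.biasCoef C L m) * (1 + η * M.lamMax + η * M.biasCoef C L m)
    * (n : ℝ) ^ (-(1 / 2) + γ)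

/-- `c_n`. -/
def cConst (C L γ : ℝ) (m : ℕ) (η : ℝ) (n : ℕ) : ℝ :=
  η * M.lamMax / 2 * (d * C ^ 2 * (n : ℝ) ^ (-2 * γ) + (1 + M.biasCoef C L m) ^ 2)
    * (n : ℝ) ^ (-1 + 2 * γ)

/-- `r_n = (b_n + √(b_n² + 4 a c_n)) / (2 a)`. -/
def rConst (C L γ : ℝ) (m : ℕ) (η : ℝ) (n : ℕ) : ℝ :=
  (M.bConst C L γ m η n
      + √(M.bConst C L γ m η n ^ 2 + 4 * M.aConst C L m η * M.cConst C L γ m η n))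
    / (2 * M.aConst C L m η)

/-- The ball `B_β = {θ ∈ Θ : ‖θ - θh‖ ≤ β r_n}`. -/
def ball (C L γ : ℝ) (m : ℕ) (η : ℝ) (n : ℕ) (β : ℝ) (θh : EuclideanSpace ℝ (Fin d)) : Set M.Θ :=
  {θ | ‖(θ : EuclideanSpace ℝ (Fin d)) - θh‖ ≤ β * M.rConst C L γ m η n}

/-- A rule that keeps the chain in `Θ`: it returns the proposed update `v` whenever `v ∈ Θ`, and an
arbitrary point of `Θ` (depending measurably on `θ` and `v`) otherwise. Examples: projection on `Θ`;
staying at `θ`. -/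
structure BoundaryRule where
  toFun : M.Θ → EuclideanSpace ℝ (Fin d) → M.Θ
  measurable_toFun : Measurable (Function.uncurry toFun)
  toFun_of_mem : ∀ (θ : M.Θ) (v : EuclideanSpace ℝ (Fin d)) (hv : v ∈ M.Θ), toFun θ v = ⟨v, hv⟩

/-- The law of the independent `m`-step MCMC outputs `X_i^{(m)} ∼ k_θ^m(x_i, ·)`, `i = 1, …, n`,
as a function of `θ`. -/
def mcmcSample (m : ℕ) {n : ℕ} (x : Fin n → M.X) : Kernel M.Θ (Fin n → M.X) where
  toFun θ := Measure.pi fun i => M.kPow m (θ, x i)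
  measurable' := by
    refine Measurable.measure_of_isPiSystem_of_isProbabilityMeasure generateFrom_pi.symm
      isPiSystem_pi ?_
    rintro _ ⟨s, hs, rfl⟩
    simp only [Measure.pi_pi]
    refine Finset.measurable_prod _ fun i _ => ?_
    exact ((M.kPow m).measurable_coe (hs i (mem_univ i))).comp (by fun_prop)

instance (m : ℕ) {n : ℕ} (x : Fin n → M.X) : IsMarkovKernel (M.mcmcSample m x) :=
  ⟨fun θ => inferInstanceAs (IsProbabilityMeasure (Measure.pi fun i => M.kPow m (θ, x i)))⟩

/-- The contrastive divergence update of `θ` from the data `x` and the MCMC outputs `y`, before the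
boundary rule: `θ + η [(1/n) ∑ φ(x_i) - (1/n) ∑ φ(y_i)]`. -/
def cdUpdate (η : ℝ) {n : ℕ} (x : Fin n → M.X) (θ : M.Θ) (y : Fin n → M.X) :
    EuclideanSpace ℝ (Fin d) :=
  (θ : EuclideanSpace ℝ (Fin d)) + η • (M.meanφ x - M.meanφ y)

/-- The transition kernel on `Θ` of the contrastive divergence chain `(θ_t)` given the data `x`. -/
def cdKernel (m : ℕ) (η : ℝ) {n : ℕ} (x : Fin n → M.X) (R : M.BoundaryRule) : Kernel M.Θ M.Θ :=
  (Kernel.id ×ₖ M.mcmcSample m x).map fun q => R.toFun q.1 (M.cdUpdate η x q.1 q.2)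

theorem measurable_cdStep (η : ℝ) {n : ℕ} (x : Fin n → M.X) (R : M.BoundaryRule) :
    Measurable fun q : M.Θ × (Fin n → M.X) => R.toFun q.1 (M.cdUpdate η x q.1 q.2) := by
  have hφ := M.measurable_φ
  have h : Measurable fun q : M.Θ × (Fin n → M.X) => M.cdUpdate η x q.1 q.2 := by
    unfold cdUpdate meanφ
    fun_prop
  exact R.measurable_toFun.comp (measurable_fst.prodMk h)

instance (m : ℕ) (η : ℝ) {n : ℕ} (x : Fin n → M.X) (R : M.BoundaryRule) :
    IsMarkovKernel (M.cdKernel m η x R) :=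
  Kernel.IsMarkovKernel.map _ (M.measurable_cdStep η x R)

end Model

end ContrastiveDivergence

end

/-! ### Hitting times and minorization -/

/-! No drift estimate is needed: with the sample fixed, the chain dominates a multiple of Lebesgue
measure near its current state, uniformly in the state, and on a convex body this forces recurrence
to every ball.

The domination starts with one coordinate. By A6 the last MCMC step gives `φ(Y)` a density bounded
below on `φ(X)`, with a bound depending on the point it starts from; A4 and compactness of `Θ` make
the resulting bound for `k_θ^m` uniform in `θ` (`exists_kPow_minorization`). Averaging `n`
independent outputs keeps a Lebesgue part around any interior point of `φ(X)`
(`volume_average_mem_ge`). The mean `μ(θ*)` is interior (`mu_mem_interior_range`), so for large `n`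
the sample mean is too, with a fixed margin. Hence from every `θ` the update dominates Lebesgue
measure on `Θ` within distance `ηρ` (`exists_cdKernel_minorization`).

Convexity of `Θ` then lets the chain step toward `θ̂` from anywhere with probability bounded below,
reaching any ball in boundedly many steps; failures have geometric tails
(`isPositiveRecurrentSet_closedBall`). A ball of diameter at most `ηρ` is moreover small
(`isSmallSet_closedBall`). Of the radius only `r_n > 0` and `r_n → 0` matter. -/

namespace MarkovChain

variable {S : Type*}

/-- The paths that avoid `B` at the times `1, …, j`. -/
def avoidSet (B : Set S) (j : ℕ) : Set (ℕ → S) := {Z | ∀ t, 1 ≤ t → t ≤ j → Z t ∉ B}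

theorem hitTime_eq_top_iff {B : Set S} {Z : ℕ → S} :
    hitTime B Z = ⊤ ↔ ∀ j, Z ∈ avoidSet B j := by
  simp only [hitTime, iInf_eq_top, mem_ofPred_eq, avoidSet]
  constructor
  · intro h j t h1 _ h2
    exact ENat.natCast_ne_top t (h t ⟨h1, h2⟩)
  · rintro h t ⟨h1, h2⟩
    exact absurd h2 (h t t h1 le_rfl)

theorem mem_avoidSet_of_lt_hitTime {B : Set S} {Z : ℕ → S} {j : ℕ} (h : (j : ℕ∞) < hitTime B Z) :
    Z ∈ avoidSet B j := by
  intro t h1 h2 h3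
  have : hitTime B Z ≤ t := iInf₂_le t ⟨h1, h3⟩
  have h4 : (t : ℕ∞) ≤ j := by exact_mod_cast h2
  exact absurd h (not_lt.2 (this.trans h4))

/-- Pathwise form of `E T = ∑ P(T > j)`: every `j < T` contributes one to the sum, also when `T =
⊤`. -/
theorem hitTime_le_tsum (B : Set S) (Z : ℕ → S) :
    ((hitTime B Z : ℕ∞) : ℝ≥0∞) ≤ ∑' j : ℕ, (avoidSet B j).indicator 1 Z := by
  have key : ∀ n : ℕ, (n : ℕ∞) ≤ hitTime B Z →
      (n : ℝ≥0∞) ≤ ∑' j : ℕ, (avoidSet B j).indicator (1 : (ℕ → S) → ℝ≥0∞) Z := by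
    intro n hn
    calc (n : ℝ≥0∞) = ∑ j ∈ Finset.range n, 1 := by simp
      _ = ∑ j ∈ Finset.range n, (avoidSet B j).indicator (1 : (ℕ → S) → ℝ≥0∞) Z := by
          refine Finset.sum_congr rfl fun j hj => ?_
          have : Z ∈ avoidSet B j := mem_avoidSet_of_lt_hitTime
            (lt_of_lt_of_le (by exact_mod_cast Finset.mem_range.1 hj) hn)
          simp [this]
      _ ≤ _ := ENNReal.sum_le_tsum _
  induction h : hitTime B Z using ENat.recTopCoe with
  | top =>
    rw [h] at key
    refine (ENNReal.eq_top_of_forall_nnreal_le fun r => ?_).ge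
    obtain ⟨n, hn⟩ := exists_nat_ge r
    exact le_trans (by exact_mod_cast hn) (key n le_top)
  | coe n => exact key n h.ge

variable [MeasurableSpace S]

theorem measurableSet_avoidSet {B : Set S} (hB : MeasurableSet B) (j : ℕ) :
    MeasurableSet (avoidSet B j) := by
  have : avoidSet B j = ⋂ t : ℕ, ⋂ (_ : 1 ≤ t), ⋂ (_ : t ≤ j), (fun Z : ℕ → S => Z t) ⁻¹' Bᶜ := by
    ext Z; simp [avoidSet]
  rw [this]
  exact .iInter fun t => .iInter fun _ => .iInter fun _ => measurable_pi_apply t hB.compl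

instance (P : Kernel S S) [IsMarkovKernel P] (z : S) : IsProbabilityMeasure (pathLaw P z) := by
  unfold pathLaw; infer_instance

/-- The Markov property at time `j`, for functionals of the history and of the next state. -/
theorem lintegral_pathLaw_succ (P : Kernel S S) [IsMarkovKernel P] (z : S) (j : ℕ)
    {f : ((i : Finset.Iic j) → S) → ℝ≥0∞} (hf : Measurable f) {g : S → ℝ≥0∞} (hg : Measurable g) :
    ∫⁻ Z, f (Preorder.frestrictLe j Z) * g (Z (j + 1)) ∂(pathLaw P z) =
      ∫⁻ Z, f (Preorder.frestrictLe j Z) * ∫⁻ y, g y ∂(P (Z j)) ∂(pathLaw P z) := by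
  set κ : (t : ℕ) → Kernel ((i : Finset.Iic t) → S) S :=
    fun t => P.comap (fun h => h ⟨t, Finset.mem_Iic.2 le_rfl⟩) (measurable_pi_apply _) with hκ
  have key := Kernel.map_frestrictLe_trajMeasure_compProd_eq_map_trajMeasure
    (X := fun _ => S) (μ₀ := Measure.dirac z) (κ := κ) (a := j)
  have hL : pathLaw P z = Kernel.trajMeasure (X := fun _ => S) (Measure.dirac z) κ := rfl
  rw [← hL] at key
  have h1 : Measurable fun q : ((i : Finset.Iic j) → S) × S => f q.1 * g q.2 :=
    (hf.comp measurable_fst).mul (hg.comp measurable_snd)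
  have e1 : ∫⁻ q, f q.1 * g q.2 ∂((pathLaw P z).map
      (fun x => (Preorder.frestrictLe (π := fun _ => S) j x, x (j + 1)))) =
      ∫⁻ Z, f (Preorder.frestrictLe j Z) * g (Z (j + 1)) ∂(pathLaw P z) := by
    rw [lintegral_map h1 (by fun_prop)]
  rw [← e1, ← key, Measure.lintegral_compProd h1,
    lintegral_map h1.lintegral_kernel_prod_right' (by fun_prop)]
  refine lintegral_congr fun Z => ?_
  simp only
  rw [lintegral_const_mul _ hg]
  rfl

/-- Avoiding `B` through time `j` is an event of the history, so the Markov property applies with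
the next state killed on `B`. -/
theorem lintegral_avoidSet_succ (P : Kernel S S) [IsMarkovKernel P] (z : S) {B : Set S}
    (hB : MeasurableSet B) (j : ℕ) {g : S → ℝ≥0∞} (hg : Measurable g) :
    ∫⁻ Z, (avoidSet B (j + 1)).indicator (fun Z => g (Z (j + 1))) Z ∂(pathLaw P z) =
      ∫⁻ Z, (avoidSet B j).indicator (fun Z => ∫⁻ y, Bᶜ.indicator g y ∂(P (Z j))) Z
        ∂(pathLaw P z) := by
  classical
  let A' : Set ((i : Finset.Iic j) → S) := {h | ∀ t : Finset.Iic j, 1 ≤ (t : ℕ) → h t ∉ B}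
  have hA' : MeasurableSet A' := by
    have : A' = ⋂ t : Finset.Iic j, ⋂ (_ : 1 ≤ (t : ℕ)),
        (fun h : (i : Finset.Iic j) → S => h t) ⁻¹' Bᶜ := by
      ext Z; simp [A']
    rw [this]
    exact .iInter fun t => .iInter fun _ => measurable_pi_apply t hB.compl
  have hmem : ∀ Z : ℕ → S, Preorder.frestrictLe (π := fun _ => S) j Z ∈ A' ↔ Z ∈ avoidSet B j := by
    intro Z
    simp only [A', avoidSet, mem_ofPred_eq]
    exact ⟨fun h t h1 h2 => h ⟨t, Finset.mem_Iic.2 h2⟩ h1,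
      fun h t h1 => h t h1 (Finset.mem_Iic.1 t.2)⟩
  have hsucc : ∀ Z : ℕ → S, Z ∈ avoidSet B (j + 1) ↔ Z ∈ avoidSet B j ∧ Z (j + 1) ∉ B := by
    intro Z
    refine ⟨fun h => ⟨fun t h1 h2 => h t h1 (by omega), h _ (by omega) le_rfl⟩, ?_⟩
    rintro ⟨h, h'⟩ t h1 h2
    rcases Nat.lt_or_ge j t with h3 | h3
    · obtain rfl : t = j + 1 := by omega
      exact h'
    · exact h t h1 h3
  have := lintegral_pathLaw_succ P z j (f := A'.indicator 1) (measurable_one.indicator hA')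
    (hg.indicator hB.compl)
  calc _ = _ := ?_
    _ = _ := this
    _ = _ := ?_
  · refine lintegral_congr fun Z => ?_
    by_cases h1 : Z ∈ avoidSet B j <;> by_cases h2 : Z (j + 1) ∈ B <;>
      simp [indicator, hmem, hsucc, h1, h2]
  · refine lintegral_congr fun Z => ?_
    by_cases h1 : Z ∈ avoidSet B j <;> simp [indicator, hmem, h1]

/-- The probability of avoiding `B` at the times `1, …, i`, as a function of the starting point. -/
noncomputable def avoidProb (P : Kernel S S) (B : Set S) : ℕ → S → ℝ≥0∞
  | 0 => 1
  | i + 1 => fun z => ∫⁻ y, Bᶜ.indicator (avoidProb P B i) y ∂(P z)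

theorem measurable_avoidProb (P : Kernel S S) {B : Set S} (hB : MeasurableSet B) (i : ℕ) :
    Measurable (avoidProb P B i) := by
  induction i with
  | zero => exact measurable_one
  | succ i ih => exact (ih.indicator hB.compl).lintegral_kernel

/-- Links path space to the recursively defined `avoidProb`. The induction moves the splitting time
`j` forward, hence the generalization over `j`. -/
theorem pathLaw_avoidSet_add (P : Kernel S S) [IsMarkovKernel P] (z : S) {B : Set S}
    (hB : MeasurableSet B) (j i : ℕ) :
    pathLaw P z (avoidSet B (j + i)) =
      ∫⁻ Z, (avoidSet B j).indicator (fun Z => avoidProb P B i (Z j)) Z ∂(pathLaw P z) := by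
  induction i generalizing j with
  | zero => exact (lintegral_indicator_one (measurableSet_avoidSet hB j)).symm
  | succ i ih =>
    rw [show j + (i + 1) = j + 1 + i by omega, ih (j + 1),
      lintegral_avoidSet_succ P z hB j (measurable_avoidProb P hB i)]
    rfl

theorem pathLaw_avoidSet_mul_le (P : Kernel S S) [IsMarkovKernel P] (z : S) {B : Set S}
    (hB : MeasurableSet B) {k : ℕ} {c : ℝ≥0∞} (h : ∀ z, avoidProb P B k z ≤ c) (l : ℕ) :
    pathLaw P z (avoidSet B (l * k)) ≤ c ^ l := by
  induction l with
  | zero => simpa using prob_le_one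
  | succ l ih =>
    rw [add_mul, one_mul, pathLaw_avoidSet_add P z hB]
    calc _ ≤ ∫⁻ Z, (avoidSet B (l * k)).indicator (fun _ => c) Z ∂(pathLaw P z) :=
          lintegral_mono fun Z => indicator_le_indicator (h _)
      _ = c * pathLaw P z (avoidSet B (l * k)) :=
          lintegral_indicator_const (measurableSet_avoidSet hB _) _
      _ ≤ c ^ (l + 1) := by rw [pow_succ']; gcongr

/-- If the probability of avoiding `B` for `k` steps is at most `c < 1`, uniformly in the starting
point, then `B` is positive recurrent. -/
theorem isPositiveRecurrentSet_of_avoidProb_le (P : Kernel S S) [IsMarkovKernel P] {B : Set S}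
    (hB : MeasurableSet B) {k : ℕ} {c : ℝ≥0∞} (hc : c < 1)
    (h : ∀ z, avoidProb P B k z ≤ c) : IsPositiveRecurrentSet P B := by
  rcases isEmpty_or_nonempty S with hS | ⟨⟨z₀⟩⟩
  · exact ⟨⟨hB, fun z => hS.elim z⟩, fun z => hS.elim z, by simp⟩
  have hk : k ≠ 0 := by
    rintro rfl
    exact absurd (h z₀) (not_le.2 hc)
  have : NeZero k := ⟨hk⟩
  have hexp : ∀ z, expHitTime P B z ≤ k * (1 - c)⁻¹ := by
    intro z
    calc expHitTime P B z ≤ ∫⁻ Z, ∑' j : ℕ, (avoidSet B j).indicator 1 Z ∂(pathLaw P z) :=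
          lintegral_mono fun Z => hitTime_le_tsum B Z
      _ = ∑' j : ℕ, pathLaw P z (avoidSet B j) := by
          rw [lintegral_tsum fun j =>
            (measurable_one.indicator (measurableSet_avoidSet hB j)).aemeasurable]
          simp_rw [lintegral_indicator_one (measurableSet_avoidSet hB _)]
      -- Times are grouped into blocks of length `k`; within block `l` the avoidance probability is
      -- at most its value `≤ c ^ l` at the start of the block.
      _ = ∑' q : ℕ × Fin k, pathLaw P z (avoidSet B (q.1 * k + q.2)) := by
          rw [← (Nat.divModEquiv k).symm.tsum_eq]
          rfl
      _ ≤ ∑' q : ℕ × Fin k, c ^ q.1 := by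
          refine ENNReal.tsum_le_tsum fun q => ?_
          refine le_trans (measure_mono ?_) (pathLaw_avoidSet_mul_le P z hB h q.1)
          exact fun Z hZ t h1 h2 => hZ t h1 (by omega)
      _ = k * (1 - c)⁻¹ := by
          rw [ENNReal.tsum_prod (f := fun (l : ℕ) (_ : Fin k) => c ^ l)]
          simp [ENNReal.tsum_mul_left, ENNReal.tsum_geometric]
  have hfin : (k : ℝ≥0∞) * (1 - c)⁻¹ < ⊤ :=
    ENNReal.mul_lt_top (by simp) (by simpa using hc)
  refine ⟨⟨hB, fun z => ?_⟩, fun z => (hexp z).trans_lt hfin,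
    (iSup₂_le fun z _ => hexp z).trans_lt hfin⟩
  have h0 : ∀ l : ℕ, pathLaw P z {Z | ¬ hitTime B Z < ⊤} ≤ c ^ l := fun l =>
    le_trans (measure_mono fun Z hZ => by
      simp only [mem_ofPred_eq, not_lt_top_iff] at hZ
      exact hitTime_eq_top_iff.1 hZ _) (pathLaw_avoidSet_mul_le P z hB h l)
  exact le_antisymm (ge_of_tendsto' (ENNReal.tendsto_pow_atTop_nhds_zero_of_lt_one hc) h0) zero_le

/-- A chain of sets leading from the whole space into `B`, each step having probability at least
`ε`, makes `B` positive recurrent. -/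
theorem isPositiveRecurrentSet_of_chain (P : Kernel S S) [IsMarkovKernel P] {B : Set S}
    (hB : MeasurableSet B) (F : ℕ → Set S) (hF : ∀ j, MeasurableSet (F j)) {k : ℕ}
    (h0 : F 0 = univ) (hk : F k ⊆ B) {ε : ℝ≥0∞} (hε : 0 < ε)
    (hstep : ∀ j, ∀ z ∈ F j, ε ≤ P z (F (j + 1))) : IsPositiveRecurrentSet P B := by
  rcases isEmpty_or_nonempty S with hS | ⟨⟨z₀⟩⟩
  · exact ⟨⟨hB, fun z => hS.elim z⟩, fun z => hS.elim z, by simp⟩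
  have hε1 : ε ≤ 1 := (hstep 0 z₀ (by simp [h0])).trans prob_le_one
  have hle : ∀ i z, Bᶜ.indicator (avoidProb P B i) z ≤ 1 := by
    intro i
    induction i with
    | zero => exact fun z => indicator_le_self' (by simp) z |>.trans le_rfl
    | succ i ih =>
      intro z
      refine (indicator_le_self' (by simp) z).trans ?_
      calc _ ≤ ∫⁻ y, 1 ∂(P z) := lintegral_mono ih
        _ = 1 := by simp
  -- Backward induction along the chain of sets. The indicator counts a current state in `B` as a
  -- visit, which settles `i = 0` because `F k ⊆ B`.
  have hmain : ∀ i j, j + i = k → ∀ z ∈ F j, Bᶜ.indicator (avoidProb P B i) z ≤ 1 - ε ^ i := by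
    intro i
    induction i with
    | zero =>
      rintro j rfl z hz
      simp [indicator, hk hz]
    | succ i ih =>
      intro j hj z hz
      refine (indicator_le_self' (by simp) z).trans ?_
      have h1 : ∀ y, Bᶜ.indicator (avoidProb P B i) y + (F (j + 1)).indicator (fun _ => ε ^ i) y
          ≤ 1 := by
        intro y
        by_cases hy : y ∈ F (j + 1)
        · rw [indicator_of_mem hy]
          calc _ ≤ 1 - ε ^ i + ε ^ i := by gcongr; exact ih (j + 1) (by omega) y hy
            _ = 1 := tsub_add_cancel_of_le (pow_le_one₀ zero_le hε1)
        · simpa [indicator_of_notMem hy] using hle i y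
      have h2 : avoidProb P B (i + 1) z + ε ^ i * P z (F (j + 1)) ≤ 1 := by
        calc _ = ∫⁻ y, (Bᶜ.indicator (avoidProb P B i) y
                + (F (j + 1)).indicator (fun _ => ε ^ i) y) ∂(P z) := by
              rw [lintegral_add_left ((measurable_avoidProb P hB i).indicator hB.compl),
                lintegral_indicator_const (hF _)]
              rfl
          _ ≤ ∫⁻ y, 1 ∂(P z) := lintegral_mono h1
          _ = 1 := by simp
      have h3 : ε ^ (i + 1) ≤ ε ^ i * P z (F (j + 1)) := by
        rw [pow_succ]; gcongr; exact hstep j z hz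
      refine ENNReal.le_sub_of_add_le_right
        (ne_top_of_le_ne_top ENNReal.one_ne_top (pow_le_one₀ zero_le hε1)) ?_
      exact le_trans (by gcongr) h2
  have hεk : (0 : ℝ≥0∞) < ε ^ k := ENNReal.pow_pos hε k
  -- One extra step: `hmain` counts a visit at time zero and hitting times do not. The first move
  -- may land anywhere, since `F 0` is everything.
  refine isPositiveRecurrentSet_of_avoidProb_le P hB (k := k + 1) (c := 1 - ε ^ k)
    (ENNReal.sub_lt_self ENNReal.one_ne_top one_ne_zero hεk.ne') fun z => ?_
  calc avoidProb P B (k + 1) z ≤ ∫⁻ _, (1 - ε ^ k) ∂(P z) :=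
        lintegral_mono fun y => hmain k 0 (by omega) y (by simp [h0])
    _ = 1 - ε ^ k := by simp

theorem IsPositiveRecurrentSet.isAccessibleSet {P : Kernel S S} [IsMarkovKernel P] {B : Set S}
    (h : IsPositiveRecurrentSet P B) : IsAccessibleSet P B := by
  refine ⟨h.1.1, fun z => ?_⟩
  have : pathLaw P z {Z | hitTime B Z < ⊤} = 1 :=
    (measure_congr (Filter.eventuallyEq_univ.2 (h.1.2 z))).trans measure_univ
  rw [this]
  exact one_pos

end MarkovChain

/-! ### Minorization of the `m`-step MCMC kernels, uniformly in the parameter -/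

namespace ContrastiveDivergence.Model

variable {p d : ℕ} (M : Model p d)

theorem measurable_integral_kernel (κ : Kernel (M.Θ × M.X) M.X) [IsMarkovKernel κ]
    (θ : M.Θ) {f : M.X → ℝ}
    (hf : Measurable f) : Measurable fun x => ∫ y, f y ∂(κ (θ, x)) := by
  have := (hf.stronglyMeasurable.comp_measurable measurable_snd).integral_kernel_prod_right'
    (κ := κ.comap (fun x : M.X => (θ, x)) measurable_prodMk_left) (f := fun q : M.X × M.X => f q.2)
  exact this.measurable

theorem abs_integral_le_one {Ω : Type*} [MeasurableSpace Ω] {μ : Measure Ω} [IsProbabilityMeasure μ]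
    {f : Ω → ℝ} (hf : ∀ x, |f x| ≤ 1) : |∫ x, f x ∂μ| ≤ 1 := by
  simpa using norm_integral_le_of_norm_le_const (μ := μ) (f := f) (C := 1) (.of_forall hf)

theorem integrable_of_abs_le_one {Ω : Type*} [MeasurableSpace Ω] {μ : Measure Ω}
    [IsProbabilityMeasure μ] {f : Ω → ℝ} (hm : Measurable f) (hf : ∀ x, |f x| ≤ 1) :
    Integrable f μ :=
  .of_bound hm.aestronglyMeasurable 1 (.of_forall hf)

theorem integral_kPow_succ (m : ℕ) (q : M.Θ × M.X) {f : M.X → ℝ} (hm : Measurable f)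
    (hf : ∀ x, |f x| ≤ 1) :
    ∫ y, f y ∂(M.kPow (m + 1) q) = ∫ z, ∫ y, f y ∂(M.k (q.1, z)) ∂(M.kPow m q) := by
  have h : ∀ s, MeasurableSet s → M.kPow (m + 1) q s =
      ((M.kPow m q).bind (M.k.sectR q.1)) s := by
    intro s hs
    rw [kPow, Kernel.comp_apply' _ _ _ hs, Kernel.prod_apply,
      Kernel.deterministic_apply, Measure.dirac_prod,
      lintegral_map (Kernel.measurable_coe _ hs) (by fun_prop),
      Measure.bind_apply hs (Kernel.aemeasurable _)]
    rfl
  have h' : M.kPow (m + 1) q = (M.k.sectR q.1 ∘ₖ Kernel.const Unit (M.kPow m q)) () := by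
    rw [Measure.ext h, Kernel.comp_apply, Kernel.const_apply]
  rw [h', Kernel.integral_comp (integrable_of_abs_le_one hm hf)]
  rfl

theorem kPow_succ_apply (m : ℕ) (q : M.Θ × M.X) {s : Set M.X} (hs : MeasurableSet s) :
    M.kPow (m + 1) q s = ∫⁻ z, M.k (q.1, z) s ∂(M.kPow m q) := by
  rw [kPow, Kernel.comp_apply' _ _ _ hs, Kernel.prod_apply,
    Kernel.deterministic_apply, Measure.dirac_prod,
    lintegral_map (Kernel.measurable_coe _ hs) (by fun_prop)]

/-- The `m`-step kernels are Lipschitz in `θ` for the total variation distance. -/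
theorem abs_integral_kPow_sub_le {ζ : ℝ}
    (hζ : ∀ (θ θ' : M.Θ) (f : M.X → ℝ), Measurable f → (∀ x, |f x| ≤ 1) → ∀ x,
      |∫ y, f y ∂(M.k (θ, x)) - ∫ y, f y ∂(M.k (θ', x))| ≤
        ζ * ‖(θ : EuclideanSpace ℝ (Fin d)) - θ'‖)
    (m : ℕ) (θ θ' : M.Θ) {f : M.X → ℝ} (hm : Measurable f) (hf : ∀ x, |f x| ≤ 1) (x : M.X) :
    |∫ y, f y ∂(M.kPow m (θ, x)) - ∫ y, f y ∂(M.kPow m (θ', x))| ≤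
      m * (ζ * ‖(θ : EuclideanSpace ℝ (Fin d)) - θ'‖) := by
  induction m generalizing f with
  | zero => simp [kPow, Kernel.deterministic_apply]
  | succ m ih =>
    rw [integral_kPow_succ M m _ hm hf, integral_kPow_succ M m _ hm hf]
    have hg := M.measurable_integral_kernel M.k θ hm
    have hg' := M.measurable_integral_kernel M.k θ' hm
    -- Markov operators preserve the unit ball of bounded functions, so the errors from changing one
    -- kernel at a time add up.
    have hb : ∀ t : M.Θ, ∀ z, |∫ y, f y ∂(M.k (t, z))| ≤ 1 := fun t z => abs_integral_le_one hf
    have h1 := ih hg' (hb θ')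
    have h2 : |∫ z, ∫ y, f y ∂(M.k (θ, z)) ∂(M.kPow m (θ, x)) -
        ∫ z, ∫ y, f y ∂(M.k (θ', z)) ∂(M.kPow m (θ, x))| ≤
        ζ * ‖(θ : EuclideanSpace ℝ (Fin d)) - θ'‖ := by
      rw [← integral_sub (integrable_of_abs_le_one hg (hb θ))
        (integrable_of_abs_le_one hg' (hb θ'))]
      have := norm_integral_le_of_norm_le_const (μ := M.kPow m (θ, x))
        (f := fun z => ∫ y, f y ∂(M.k (θ, z)) - ∫ y, f y ∂(M.k (θ', z)))
        (.of_forall fun z => hζ θ θ' f hm hf z)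
      simpa only [probReal_univ, mul_one, Real.norm_eq_abs] using this
    calc _ ≤ _ := abs_sub_le _ (∫ z, ∫ y, f y ∂(M.k (θ', z)) ∂(M.kPow m (θ, x))) _
      _ ≤ _ := add_le_add h2 h1
      _ = _ := by push_cast; ring

/-- For a fixed starting point and `m ≥ 1`, the laws of `φ(X^(m))` dominate a common multiple of
Lebesgue measure on subsets of the range of `φ`, uniformly in `θ`. -/
theorem exists_kPow_minorization (hΘ : IsCompact M.Θ) (h4 : M.A4) (h6 : M.A6) (m : ℕ) (x : M.X) :
    ∃ c : ℝ≥0∞, 0 < c ∧ c ≠ ⊤ ∧ ∀ θ : M.Θ, ∀ A : Set (EuclideanSpace ℝ (Fin d)),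
      MeasurableSet A → A ⊆ range M.φ → c * volume A ≤ M.kPow (m + 1) (θ, x) (M.φ ⁻¹' A) := by
  obtain ⟨ζ, hζ⟩ := h4
  obtain ⟨-, ρ, hρm, hρ, hpos⟩ := h6
  set ι : M.X → ℝ≥0∞ := fun y => ⨅ θ : M.Θ, ⨅ v ∈ range M.φ, ρ θ y v with hι
  have hk : ∀ θ : M.Θ, ∀ y, ∀ A : Set (EuclideanSpace ℝ (Fin d)), MeasurableSet A →
      A ⊆ range M.φ → ι y * volume A ≤ M.k (θ, y) (M.φ ⁻¹' A) := by
    intro θ y A hA hAr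
    rw [← Measure.map_apply M.measurable_φ hA, hρ, withDensity_apply _ hA, ← setLIntegral_const]
    exact setLIntegral_mono (hρm θ y) fun v hv => iInf_le_of_le θ (iInf₂_le v (hAr hv))
  -- Having a common constant passes to subsets and, by taking minima, to unions; compactness
  -- reduces the claim to a neighbourhood of each parameter.
  have hcont := hΘ.induction_on (p := fun s => ∃ c : ℝ≥0∞, 0 < c ∧ c ≠ ⊤ ∧ ∀ θ : M.Θ, ↑θ ∈ s →
      ∀ A : Set (EuclideanSpace ℝ (Fin d)), MeasurableSet A → A ⊆ range M.φ →
        c * volume A ≤ M.kPow (m + 1) (θ, x) (M.φ ⁻¹' A)) ?_ ?_ ?_ ?_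
  · obtain ⟨c, hc, hct, h⟩ := hcont
    exact ⟨c, hc, hct, fun θ => h θ θ.2⟩
  · exact ⟨1, one_pos, ENNReal.one_ne_top, by simp⟩
  · rintro s t hst ⟨c, hc, hct, h⟩
    exact ⟨c, hc, hct, fun θ hθ => h θ (hst hθ)⟩
  · rintro s t ⟨c, hc, hct, h⟩ ⟨c', hc', hct', h'⟩
    refine ⟨min c c', lt_min hc hc', ne_top_of_le_ne_top hct (min_le_left _ _), ?_⟩
    rintro θ (hθ | hθ) A hA hAr
    · exact le_trans (by gcongr; exact min_le_left _ _) (h θ hθ A hA hAr)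
    · exact le_trans (by gcongr; exact min_le_right _ _) (h' θ hθ A hA hAr)
  · intro t₀ ht₀
    set θ₀ : M.Θ := ⟨t₀, ht₀⟩
    set U : ℕ → Set M.X := fun j => {y | ((j : ℝ≥0∞) + 1)⁻¹ ≤ ι y} with hU
    have hUmono : Monotone U := fun i j hij y hy =>
      le_trans (ENNReal.inv_le_inv.2 (by gcongr)) hy
    have hUuniv : ⋃ j, U j = univ := by
      refine eq_univ_of_forall fun y => mem_iUnion.2 ?_
      obtain ⟨j, hj⟩ := ENNReal.exists_inv_nat_lt (hpos y).ne'
      exact ⟨j, le_trans (ENNReal.inv_le_inv.2 le_self_add) hj.le⟩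
    -- The sets `U j` exhaust `X` because `ι` is positive everywhere. With `δ` below, moving `θ`
    -- costs at most `1/4` of this mass, so `1/4` remains.
    obtain ⟨j, hj⟩ : ∃ j, (2 : ℝ≥0∞)⁻¹ < M.kPow m (θ₀, x) (U j) := by
      rw [← lt_iSup_iff, ← hUmono.measure_iUnion, hUuniv, measure_univ]
      exact ENNReal.one_half_lt_one
    have hδ : ∃ δ : ℝ, 0 < δ ∧ m * (|ζ| * δ) ≤ 1 / 4 := by
      refine ⟨1 / (4 * (m * |ζ| + 1)), by positivity, ?_⟩
      rw [← mul_assoc, mul_one_div, div_le_div_iff₀ (by positivity) (by positivity)]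
      nlinarith [show (0 : ℝ) ≤ m * |ζ| by positivity]
    obtain ⟨δ, hδ0, hδ⟩ := hδ
    refine ⟨Metric.ball t₀ δ ∩ M.Θ,
      Filter.inter_mem (nhdsWithin_le_nhds (Metric.ball_mem_nhds _ hδ0))
      self_mem_nhdsWithin, ((j : ℝ≥0∞) + 1)⁻¹ * 4⁻¹, ?_, ?_, ?_⟩
    · exact ENNReal.mul_pos (by simp) (by simp)
    · exact ENNReal.mul_ne_top (by simp) (by simp)
    · rintro θ ⟨hθ, -⟩ A hA hAr
      -- `ι` is a possibly uncountable infimum, so measurability of `U j` is not clear; `W` is a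
      -- measurable superset on which the needed bound still holds.
      set W : Set M.X := {y | ((j : ℝ≥0∞) + 1)⁻¹ * volume A ≤ M.k (θ, y) (M.φ ⁻¹' A)} with hW
      have hWm : MeasurableSet W := by
        have : Measurable fun y => M.k (θ, y) (M.φ ⁻¹' A) :=
          (M.k.measurable_coe (M.measurable_φ hA)).comp (by fun_prop)
        exact measurableSet_le measurable_const this
      have hUW : U j ⊆ W := fun y hy =>
        le_trans (mul_le_mul_left hy _) (hk θ y A hA hAr)
      have h1 : (1 / 2 : ℝ) ≤ (M.kPow m (θ₀, x)).real W := by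
        have := (ENNReal.toReal_le_toReal (by simp) (measure_ne_top _ _)).2
          (hj.le.trans (measure_mono hUW))
        simpa [Measure.real] using this
      have h2 := M.abs_integral_kPow_sub_le hζ m θ θ₀ (f := W.indicator 1)
        (measurable_one.indicator hWm) (fun y => by by_cases hy : y ∈ W <;> simp [hy]) x
      rw [integral_indicator_one hWm, integral_indicator_one hWm] at h2
      have h3 : (m : ℝ) * (ζ * ‖(θ : EuclideanSpace ℝ (Fin d)) - θ₀‖) ≤ 1 / 4 := by
        refine le_trans ?_ hδ
        gcongr
        · exact le_abs_self ζ
        · exact (mem_ball_iff_norm.1 hθ).le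
      have h4 : (1 / 4 : ℝ) ≤ (M.kPow m (θ, x)).real W := by
        have := abs_le.1 (h2.trans h3)
        linarith
      have h5 : (4 : ℝ≥0∞)⁻¹ ≤ M.kPow m (θ, x) W := by
        have := ENNReal.ofReal_le_ofReal h4
        rw [ofReal_measureReal] at this
        simpa [ENNReal.ofReal_inv_of_pos] using this
      rw [kPow_succ_apply _ _ _ (M.measurable_φ hA)]
      calc ((j : ℝ≥0∞) + 1)⁻¹ * 4⁻¹ * volume A
          = ((j : ℝ≥0∞) + 1)⁻¹ * volume A * 4⁻¹ := by ring
        _ ≤ ((j : ℝ≥0∞) + 1)⁻¹ * volume A * M.kPow m (θ, x) W := by gcongr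
        _ = ∫⁻ _ in W, ((j : ℝ≥0∞) + 1)⁻¹ * volume A ∂(M.kPow m (θ, x)) :=
            (setLIntegral_const _ _).symm
        _ ≤ ∫⁻ z in W, M.k (θ, z) (M.φ ⁻¹' A) ∂(M.kPow m (θ, x)) :=
            setLIntegral_mono' hWm fun z hz => hz
        _ ≤ _ := setLIntegral_le_lintegral _ _

end ContrastiveDivergence.Model

/-! ### Product measures and averages of independent vectors -/

namespace ContrastiveDivergence

/-- Product measures are monotone in their factors. -/
theorem pi_le_pi {ι : Type*} [Fintype ι] {α : ι → Type*} [∀ i, MeasurableSpace (α i)]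
    {μ ν : ∀ i, Measure (α i)} [∀ i, SigmaFinite (μ i)] (h : ∀ i, μ i ≤ ν i) :
    Measure.pi μ ≤ Measure.pi ν := by
  refine Measure.le_iff.2 fun s hs => ?_
  conv_rhs => rw [Measure.pi, toMeasure_apply _ _ hs]
  -- The product outer measure is the largest one bounded by the product on boxes, so only boxes
  -- need comparing.
  refine OuterMeasure.le_pi.2 ?_ s
  intro t _
  change Measure.pi μ (univ.pi t) ≤ _
  rw [Measure.pi_pi]
  exact Finset.prod_le_prod' fun i _ => h i (t i)

theorem norm_average_le {E : Type*} [SeminormedAddCommGroup E] [NormedSpace ℝ E] {n : ℕ}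
    (v : Fin n → E) {r : ℝ} (hr : 0 ≤ r) (hv : ∀ i, ‖v i‖ ≤ r) :
    ‖(n : ℝ)⁻¹ • ∑ i, v i‖ ≤ r := by
  rw [norm_smul, norm_inv, RCLike.norm_natCast]
  rcases Nat.eq_zero_or_pos n with rfl | hn
  · simpa using hr
  · have h := norm_sum_le_of_le Finset.univ fun i _ => hv i
    simp only [Finset.sum_const, Finset.card_univ, Fintype.card_fin, nsmul_eq_mul] at h
    have hn' : (0 : ℝ) < n := by exact_mod_cast hn
    rw [inv_mul_le_iff₀ hn']
    exact h

section Average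

variable {E : Type*} [NormedAddCommGroup E] [InnerProductSpace ℝ E] [FiniteDimensional ℝ E]
  [MeasurableSpace E] [BorelSpace E]

/-- The average of `n` points of the ball `B(v₀, 2ρ)` has an absolutely continuous part bounded
below on `B(v₀, ρ)`. -/
theorem volume_average_mem_ge {n : ℕ} (hn : n ≠ 0) (v₀ : E) {ρ : ℝ} (hρ : 0 < ρ) {A : Set E}
    (hA : MeasurableSet A) (hAρ : A ⊆ Metric.closedBall v₀ ρ) :
    volume (univ.pi fun _ : Fin n => Metric.closedBall (0 : E) (ρ / 2)) * volume A ≤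
      volume (Metric.closedBall v₀ (2 * ρ)) *
        volume {v : Fin n → E | (∀ i, v i ∈ Metric.closedBall v₀ (2 * ρ)) ∧
          (n : ℝ)⁻¹ • ∑ i, v i ∈ A} := by
  set f : (Fin n → E) → E := fun v => (n : ℝ)⁻¹ • ∑ i, v i with hf
  have hfm : Measurable f := by fun_prop
  set K := Metric.closedBall v₀ (2 * ρ) with hK
  set G : Set (Fin n → E) := {v | (∀ i, v i ∈ K) ∧ f v ∈ A} with hG
  have hGm : MeasurableSet G := by
    have : G = (⋂ i, (fun v : Fin n → E => v i) ⁻¹' K) ∩ f ⁻¹' A := by ext v; simp [hG]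
    rw [this]
    exact (MeasurableSet.iInter fun i =>
      measurable_pi_apply i Metric.isClosed_closedBall.measurableSet).inter (hfm hA)
  set S : Set (Fin n → E) := univ.pi fun _ => Metric.closedBall (0 : E) (ρ / 2) with hS
  have hSm : MeasurableSet S := .univ_pi fun _ => Metric.isClosed_closedBall.measurableSet
  -- Key to the proof: a common shift `u` of all points shifts the average by `u`. For fixed `v`
  -- near zero the admissible shifts contain a translate of `A`; Tonelli and translation invariance
  -- then convert this into the volume of `G`.
  have hfadd : ∀ (v : Fin n → E) (u : E), f (v + fun _ => u) = f v + u := by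
    intro v u
    simp only [hf, Pi.add_apply, Finset.sum_add_distrib, Finset.sum_const, Finset.card_univ,
      Fintype.card_fin, smul_add]
    rw [← Nat.cast_smul_eq_nsmul ℝ, smul_smul, inv_mul_cancel₀ (by exact_mod_cast hn), one_smul]
  have hshift : Measurable fun q : E × (Fin n → E) => G.indicator (1 : (Fin n → E) → ℝ≥0∞)
      (q.2 + fun _ => q.1) :=
    (measurable_one.indicator hGm).comp (by fun_prop)
  calc volume S * volume A = ∫⁻ v in S, volume A := by rw [setLIntegral_const, mul_comm]
    _ ≤ ∫⁻ v in S, ∫⁻ u in K, G.indicator 1 (v + fun _ => u) := by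
        refine setLIntegral_mono' hSm fun v hv => ?_
        have hv' : ∀ i, ‖v i‖ ≤ ρ / 2 := fun i => by simpa using hv i (mem_univ i)
        have hfv : ‖f v‖ ≤ ρ / 2 := norm_average_le v (by positivity) hv'
        have e1 : ∫⁻ u in K, G.indicator 1 (v + fun _ => u) =
            (volume.restrict K) ((fun u => v + fun _ => u) ⁻¹' G) := by
          rw [← lintegral_indicator_one (hGm.preimage (by fun_prop))]
          rfl
        rw [e1, Measure.restrict_apply (hGm.preimage (by fun_prop)),
          ← measure_preimage_add volume (f v) A]
        refine measure_mono fun u hu => ?_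
        have hu1 : f v + u ∈ A := hu
        have hu2 := mem_closedBall_iff_norm.1 (hAρ hu1)
        have hu3 : ‖u - v₀‖ ≤ 3 / 2 * ρ := by
          calc ‖u - v₀‖ = ‖(f v + u - v₀) - f v‖ := by congr 1; abel
            _ ≤ _ := norm_sub_le _ _
            _ ≤ _ := by linarith
        refine ⟨⟨fun i => ?_, by rw [hfadd]; exact hu1⟩, ?_⟩
        · rw [hK, mem_closedBall_iff_norm]
          calc ‖v i + u - v₀‖ = ‖v i + (u - v₀)‖ := by congr 1; abel
            _ ≤ _ := norm_add_le _ _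
            _ ≤ _ := by linarith [hv' i]
        · rw [hK, mem_closedBall_iff_norm]
          linarith
    _ ≤ ∫⁻ v, ∫⁻ u in K, G.indicator 1 (v + fun _ => u) := setLIntegral_le_lintegral _ _
    _ = ∫⁻ u in K, ∫⁻ v, G.indicator 1 (v + fun _ => u) :=
        (lintegral_lintegral_swap hshift.aemeasurable).symm
    _ = ∫⁻ u in K, volume G := by
        refine lintegral_congr fun u => ?_
        rw [lintegral_add_right_eq_self (fun v => G.indicator (1 : (Fin n → E) → ℝ≥0∞) v),
          lintegral_indicator_one hGm]
    _ = volume K * volume G := by rw [setLIntegral_const, mul_comm]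

end Average

/-! ### Interior mean and minorization of the CD chain -/

namespace Model

variable {p d : ℕ} (M : Model p d)

theorem isProbabilityMeasure_P {C : ℝ} (h1 : M.A1 C) (θ : EuclideanSpace ℝ (Fin d)) :
    IsProbabilityMeasure (M.P θ) := by
  unfold P expFamily
  set ν := (leb M.X).withDensity (fun x => (M.c x : ℝ≥0∞)) with hν
  have hu : ν univ = ∫⁻ x, M.c x ∂(leb M.X) := by
    rw [hν, withDensity_apply _ .univ, setLIntegral_univ]
  have : IsFiniteMeasure ν := ⟨by rw [hu]; exact M.carrier_ne_top.lt_top⟩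
  have : NeZero ν := ⟨fun h => M.carrier_ne_zero (by rw [← hu, h]; simp)⟩
  have hm := M.measurable_φ
  refine isProbabilityMeasure_tilted (.of_bound (C := Real.exp (∑ j, |θ j| * C))
    (by fun_prop) (.of_forall fun x => ?_))
  rw [Real.norm_eq_abs, Real.abs_exp, Real.exp_le_exp]
  rw [PiLp.inner_apply]
  refine Finset.sum_le_sum fun j _ => ?_
  calc inner ℝ (θ j) (M.φ x j) ≤ |inner ℝ (θ j) (M.φ x j)| := le_abs_self _
    _ = |θ j| * |M.φ x j| := by simp [abs_mul, mul_comm]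
    _ ≤ _ := by gcongr; exact h1 x j

theorem norm_φ_le {C : ℝ} (h1 : M.A1 C) (x : M.X) : ‖M.φ x‖ ≤ √(d * C ^ 2) := by
  rw [EuclideanSpace.norm_eq]
  refine Real.sqrt_le_sqrt ?_
  calc _ ≤ ∑ _j : Fin d, C ^ 2 := Finset.sum_le_sum fun j _ => by
        rw [Real.norm_eq_abs]
        gcongr
        exact h1 x j
    _ = _ := by simp

theorem integrable_φ {C : ℝ} (h1 : M.A1 C) (μ : Measure M.X) [IsFiniteMeasure μ] :
    Integrable M.φ μ :=
  .of_bound M.measurable_φ.aestronglyMeasurable _ (.of_forall (M.norm_φ_le h1))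

/-- Under `A6`, the law of the sufficient statistic under `p_θ` is absolutely continuous. -/
theorem P_preimage_φ_eq_zero (h6 : M.A6) (θ : M.Θ) {N : Set (EuclideanSpace ℝ (Fin d))}
    (hN : volume N = 0) : M.P θ (M.φ ⁻¹' N) = 0 := by
  obtain ⟨-, ρ, -, hρ, -⟩ := h6
  refine measure_mono_null (preimage_mono (subset_toMeasurable volume N)) ?_
  have hT := measurableSet_toMeasurable volume N
  have hinv : (M.P θ).bind (M.k.sectR θ) = M.P θ := M.invariant_k θ
  rw [← hinv, Measure.bind_apply (M.measurable_φ hT) (Kernel.aemeasurable _)]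
  refine (lintegral_congr fun x => ?_).trans lintegral_zero
  rw [Kernel.sectR_apply, ← Measure.map_apply M.measurable_φ hT, hρ]
  exact withDensity_absolutelyContinuous _ _ (by rwa [measure_toMeasurable])

/-- The law of `φ` does not charge Lebesgue null sets. So the convex set `φ(X)` has interior, its
frontier being null. Were the mean not interior, a separating functional would attain its maximum
over `φ(X)` in the mean, forcing `φ` almost surely into a hyperplane, which is null. -/
theorem mu_mem_interior_range {C : ℝ} (h1 : M.A1 C) (h6 : M.A6) (θ : M.Θ) :
    M.mu θ ∈ interior (range M.φ) := by
  have := M.isProbabilityMeasure_P h1 θ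
  have hconv := h6.1
  have hne : (interior (range M.φ)).Nonempty := by
    by_contra hemp
    rw [not_nonempty_iff_eq_empty] at hemp
    have h0 : volume (range M.φ) = 0 := by
      refine measure_mono_null ?_ (hconv.addHaar_frontier volume)
      rw [frontier, hemp, sdiff_empty]
      exact subset_closure
    have := M.P_preimage_φ_eq_zero h6 θ h0
    rw [preimage_range, measure_univ] at this
    exact one_ne_zero this
  by_contra hmu
  obtain ⟨f, hf⟩ := geometric_hahn_banach_open_point hconv.interior isOpen_interior hmu
  have hle : ∀ x, f (M.φ x) ≤ f (M.mu θ) := by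
    intro x
    have hx : M.φ x ∈ closure (interior (range M.φ)) := by
      rw [hconv.closure_interior_eq_closure_of_nonempty_interior hne]
      exact subset_closure (mem_range_self x)
    exact closure_minimal (fun a ha => (hf a ha).le)
      (isClosed_le f.continuous continuous_const) hx
  have hint := M.integrable_φ h1 (M.P θ)
  have hzero : ∫ x, (f (M.mu θ) - f (M.φ x)) ∂(M.P θ) = 0 := by
    rw [integral_sub (integrable_const _) (f.integrable_comp hint), f.integral_comp_comm hint]
    simp [mu]
  rw [integral_eq_zero_iff_of_nonneg (fun x => sub_nonneg.2 (hle x))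
    ((integrable_const _).sub (f.integrable_comp hint))] at hzero
  have hker : volume ((fun v => v - M.mu θ) ⁻¹' (LinearMap.ker f.toLinearMap :
      Set (EuclideanSpace ℝ (Fin d)))) = 0 := by
    simp_rw [sub_eq_add_neg]
    rw [measure_preimage_add_right]
    refine Measure.addHaar_submodule _ _ fun htop => ?_
    obtain ⟨a, ha⟩ := hne
    have h0 : ∀ v, f v = 0 := fun v => by
      have : v ∈ LinearMap.ker f.toLinearMap := htop ▸ Submodule.mem_top
      exact this
    have := hf a ha
    rw [h0, h0] at this
    exact lt_irrefl _ this
  have hnull := M.P_preimage_φ_eq_zero h6 θ hker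
  have hall : ∀ᵐ x ∂(M.P θ), x ∉ M.φ ⁻¹' ((fun v => v - M.mu θ) ⁻¹'
      (LinearMap.ker f.toLinearMap : Set (EuclideanSpace ℝ (Fin d)))) :=
    measure_eq_zero_iff_ae_notMem.1 hnull
  obtain ⟨x, hx1, hx2⟩ := (hzero.and hall).exists
  refine hx2 ?_
  have : f (M.mu θ) - f (M.φ x) = 0 := hx1
  change f (M.φ x - M.mu θ) = 0
  rw [map_sub]
  linarith

/-- The average of `φ` over the MCMC outputs has an absolutely continuous part bounded below near
`v₀`, uniformly in `θ`. -/
theorem exists_mcmcSample_minorization (hΘ : IsCompact M.Θ) (h4 : M.A4) (h6 : M.A6) {m n : ℕ}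
    (hm : m ≠ 0) (hn : n ≠ 0) (x : Fin n → M.X) (v₀ : EuclideanSpace ℝ (Fin d)) {ρ : ℝ}
    (hρ : 0 < ρ) (hball : Metric.closedBall v₀ (2 * ρ) ⊆ range M.φ) :
    ∃ c : ℝ≥0∞, 0 < c ∧ ∀ θ : M.Θ, ∀ A : Set (EuclideanSpace ℝ (Fin d)), MeasurableSet A →
      A ⊆ Metric.closedBall v₀ ρ → c * volume A ≤ M.mcmcSample m x θ {y | M.meanφ y ∈ A} := by
  -- At least one MCMC step is required: the density comes from the last one.
  obtain ⟨m, rfl⟩ := Nat.exists_eq_succ_of_ne_zero hm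
  choose c hc hct hmin using fun i => M.exists_kPow_minorization hΘ h4 h6 m (x i)
  set K := Metric.closedBall v₀ (2 * ρ) with hK
  have hKm : MeasurableSet K := Metric.isClosed_closedBall.measurableSet
  set S : Set (Fin n → EuclideanSpace ℝ (Fin d)) :=
    univ.pi fun _ => Metric.closedBall (0 : EuclideanSpace ℝ (Fin d)) (ρ / 2) with hS
  have hKpos : volume K ≠ 0 := (Metric.measure_closedBall_pos volume v₀ (by positivity)).ne'
  have hKtop : volume K ≠ ⊤ := measure_closedBall_lt_top.ne
  have hSpos : volume S ≠ 0 := by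
    rw [hS, volume_pi_pi]
    exact Finset.prod_ne_zero_iff.2 fun i _ =>
      (Metric.measure_closedBall_pos volume _ (by positivity)).ne'
  refine ⟨(∏ i, c i) * (volume S / volume K), ENNReal.mul_pos
    (Finset.prod_ne_zero_iff.2 fun i _ => (hc i).ne') (ENNReal.div_pos hSpos hKtop).ne', ?_⟩
  intro θ A hA hAρ
  set f : (Fin n → EuclideanSpace ℝ (Fin d)) → EuclideanSpace ℝ (Fin d) :=
    fun v => (n : ℝ)⁻¹ • ∑ i, v i with hf
  have hfm : Measurable f := by fun_prop
  have hφ := M.measurable_φ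
  have hfac : ∀ i, (c i) • volume.restrict K ≤ (M.kPow (m + 1) (θ, x i)).map M.φ := by
    intro i
    refine Measure.le_iff.2 fun s hs => ?_
    rw [Measure.smul_apply, Measure.restrict_apply hs, smul_eq_mul, Measure.map_apply hφ hs]
    exact (hmin i θ _ (hs.inter hKm) (inter_subset_right.trans hball)).trans
      (measure_mono (preimage_mono inter_subset_left))
  have hfin : ∀ i, IsFiniteMeasure ((c i) • volume.restrict K) := fun i => by
    have : IsFiniteMeasure (volume.restrict K) := ⟨by simpa using hKtop.lt_top⟩
    exact Measure.smul_finite _ (hct i)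
  have hpi : (∏ i, c i) • (volume : Measure (Fin n → EuclideanSpace ℝ (Fin d))).restrict
      (univ.pi fun _ => K) = Measure.pi fun i => (c i) • volume.restrict K := by
    refine (Measure.pi_eq fun s hs => ?_).symm
    rw [Measure.smul_apply, Measure.restrict_apply (.univ_pi hs), ← pi_inter_distrib, volume_pi_pi,
      smul_eq_mul, ← Finset.prod_mul_distrib]
    exact Finset.prod_congr rfl fun i _ => by
      rw [Measure.smul_apply, Measure.restrict_apply (hs i), smul_eq_mul]
  have hmap : (M.mcmcSample (m + 1) x θ).map (fun y i => M.φ (y i)) =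
      Measure.pi fun i => (M.kPow (m + 1) (θ, x i)).map M.φ :=
    Measure.pi_map_pi (f := fun _ => M.φ) fun i => hφ.aemeasurable
  have hset : MeasurableSet (f ⁻¹' A) := hfm hA
  calc (∏ i, c i) * (volume S / volume K) * volume A
      = (∏ i, c i) * (volume S * volume A / volume K) := by
        rw [mul_assoc, ENNReal.mul_div_right_comm]
    _ ≤ (∏ i, c i) * volume {v | (∀ i, v i ∈ K) ∧ f v ∈ A} := by
        gcongr
        exact ENNReal.div_le_of_le_mul' (volume_average_mem_ge hn v₀ hρ hA hAρ)
    _ = ((∏ i, c i) • (volume : Measure (Fin n → EuclideanSpace ℝ (Fin d))).restrict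
          (univ.pi fun _ => K)) (f ⁻¹' A) := by
        rw [Measure.smul_apply, Measure.restrict_apply hset, smul_eq_mul]
        congr 2
        ext v
        simp [and_comm]
    _ ≤ ((M.mcmcSample (m + 1) x θ).map (fun y i => M.φ (y i))) (f ⁻¹' A) := by
        rw [hpi, hmap]
        exact pi_le_pi hfac _
    _ = _ := Measure.map_apply (by fun_prop) hset

/-- One-step minorization for the contrastive divergence chain. -/
theorem exists_cdKernel_minorization (hΘ : IsCompact M.Θ) (h4 : M.A4) (h6 : M.A6) {m n : ℕ}
    (hm : m ≠ 0) (hn : n ≠ 0) {η : ℝ} (hη : 0 < η) (x : Fin n → M.X) {ρ : ℝ} (hρ : 0 < ρ)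
    (hball : Metric.closedBall (M.meanφ x) (2 * ρ) ⊆ range M.φ) (R : M.BoundaryRule) :
    ∃ c : ℝ≥0∞, 0 < c ∧ ∀ (θ : M.Θ) (A : Set M.Θ), MeasurableSet A →
      (∀ ψ ∈ A, ‖(ψ : EuclideanSpace ℝ (Fin d)) - θ‖ ≤ η * ρ) →
      c * (volume : Measure (EuclideanSpace ℝ (Fin d))).comap Subtype.val A ≤
        M.cdKernel m η x R θ A := by
  obtain ⟨c, hc, hmin⟩ := M.exists_mcmcSample_minorization hΘ h4 h6 hm hn x (M.meanφ x) hρ hball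
  have hΘm : MeasurableSet M.Θ := hΘ.isClosed.measurableSet
  -- The factor `η ^ (-d)` is the Jacobian of pulling back along the affine update map `g`.
  refine ⟨c * ENNReal.ofReal (|(η ^ d)⁻¹|), ENNReal.mul_pos hc.ne' (by simp [hη.ne']), ?_⟩
  intro θ A hA hAθ
  have hAm : MeasurableSet (Subtype.val '' A) :=
    (MeasurableEmbedding.subtype_coe hΘm).measurableSet_image.2 hA
  rw [(MeasurableEmbedding.subtype_coe hΘm).comap_apply]
  set g : EuclideanSpace ℝ (Fin d) → EuclideanSpace ℝ (Fin d) :=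
    fun w => (θ : EuclideanSpace ℝ (Fin d)) + η • (M.meanφ x - w) with hg
  have hgm : Measurable g := by fun_prop
  have hvol : volume (g ⁻¹' (Subtype.val '' A)) =
      ENNReal.ofReal (|(η ^ d)⁻¹|) * volume (Subtype.val '' A) := by
    have e : g ⁻¹' (Subtype.val '' A) = (fun w => M.meanφ x - w) ⁻¹' ((fun w => η • w) ⁻¹'
        ((fun w => (θ : EuclideanSpace ℝ (Fin d)) + w) ⁻¹' (Subtype.val '' A))) := rfl
    rw [e, (Measure.measurePreserving_sub_left volume (M.meanφ x)).measure_preimage_emb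
      (MeasurableEquiv.subLeft (M.meanφ x)).measurableEmbedding,
      Measure.addHaar_preimage_smul _ hη.ne', measure_preimage_add, finrank_euclideanSpace_fin]
  have hsub : g ⁻¹' (Subtype.val '' A) ⊆ Metric.closedBall (M.meanφ x) ρ := by
    rintro w ⟨ψ, hψ, hw⟩
    have h := hAθ ψ hψ
    rw [hw, hg] at h
    simp only [add_sub_cancel_left, norm_smul, Real.norm_eq_abs, abs_of_pos hη] at h
    rw [mem_closedBall_iff_norm, norm_sub_rev]
    exact le_of_mul_le_mul_left h hη
  have hstep := M.measurable_cdStep η x R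
  calc c * ENNReal.ofReal (|(η ^ d)⁻¹|) * volume (Subtype.val '' A)
      = c * volume (g ⁻¹' (Subtype.val '' A)) := by rw [hvol, mul_assoc]
    _ ≤ M.mcmcSample m x θ {y | M.meanφ y ∈ g ⁻¹' (Subtype.val '' A)} :=
        hmin θ _ (hgm hAm) hsub
    -- Since `A` lies in `Θ`, the boundary rule leaves proposals landing in `A` unchanged, whatever
    -- it does elsewhere.
    _ ≤ M.mcmcSample m x θ {y | R.toFun θ (M.cdUpdate η x θ y) ∈ A} := by
        refine measure_mono ?_
        rintro y ⟨ψ, hψ, hy⟩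
        have hy' : M.cdUpdate η x θ y = ψ := hy.symm
        change R.toFun θ (M.cdUpdate η x θ y) ∈ A
        rw [hy', R.toFun_of_mem θ ψ ψ.2]
        exact hψ
    _ = M.cdKernel m η x R θ A := by
        rw [cdKernel, Kernel.map_apply' _ hstep _ hA, Kernel.prod_apply, Kernel.id_apply,
          Measure.dirac_prod, Measure.map_apply measurable_prodMk_left (hstep hA)]
        rfl

end Model

end ContrastiveDivergence

/-! ### Chains on a convex body with local Lebesgue minorization -/

namespace MarkovChain

section ConvexState

variable {E : Type*} [NormedAddCommGroup E] {Θ : Set E}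

theorem exists_norm_sub_le (hcpt : IsCompact Θ) :
    ∃ Δ : ℝ, 0 < Δ ∧ ∀ θ ∈ Θ, ∀ ψ ∈ Θ, ‖θ - ψ‖ ≤ Δ := by
  obtain ⟨Δ, hΔ⟩ := hcpt.isBounded.exists_norm_le
  refine ⟨|Δ| + |Δ| + 1, by positivity, fun θ hθ ψ hψ => ?_⟩
  have h1 := hΔ θ hθ
  have h2 := hΔ ψ hψ
  have := norm_sub_le θ ψ
  have := le_abs_self Δ
  linarith

variable [NormedSpace ℝ E]

theorem homothety_mem (hconv : Convex ℝ Θ) {θ ψ : E} (hθ : θ ∈ Θ) (hψ : ψ ∈ Θ) {t : ℝ}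
    (ht0 : 0 ≤ t) (ht1 : t ≤ 1) : AffineMap.homothety θ t ψ ∈ Θ := by
  rw [AffineMap.homothety_eq_lineMap]
  exact hconv.lineMap_mem hθ hψ ⟨ht0, ht1⟩

variable [FiniteDimensional ℝ E] [MeasurableSpace E] [BorelSpace E]

/-- A ball around a point of a convex body meets the body in a set of positive measure. -/
theorem measure_inter_closedBall_pos (μ : Measure E) [μ.IsAddHaarMeasure] (hconv : Convex ℝ Θ)
    (hcpt : IsCompact Θ) (hint : (interior Θ).Nonempty) {θ : E} (hθ : θ ∈ Θ) {r : ℝ} (hr : 0 < r) :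
    0 < μ (Θ ∩ Metric.closedBall θ r) := by
  obtain ⟨Δ, hΔ0, hΔ⟩ := exists_norm_sub_le hcpt
  -- Shrinking the whole body toward `θ` by the ratio `u` keeps it in `Θ` and brings it within `r`
  -- of `θ`, at the cost of a positive volume factor.
  set u := min 1 (r / Δ) with hu
  have hu0 : 0 < u := lt_min one_pos (by positivity)
  have hsub : AffineMap.homothety θ u '' Θ ⊆ Θ ∩ Metric.closedBall θ r := by
    rintro _ ⟨ψ, hψ, rfl⟩
    refine ⟨homothety_mem hconv hθ hψ hu0.le (min_le_left _ _), ?_⟩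
    rw [mem_closedBall_iff_norm, AffineMap.homothety_apply]
    simp only [vsub_eq_sub, vadd_eq_add, add_sub_cancel_right, norm_smul, Real.norm_eq_abs,
      abs_of_pos hu0]
    calc u * ‖ψ - θ‖ ≤ r / Δ * Δ := by
          gcongr
          · exact min_le_right _ _
          · exact hΔ _ hψ _ hθ
      _ = r := by field_simp
  refine lt_of_lt_of_le ?_ (measure_mono hsub)
  rw [Measure.addHaar_image_homothety]
  exact ENNReal.mul_pos (by simp [hu0.ne'])
    (lt_of_lt_of_le (isOpen_interior.measure_pos μ hint) (measure_mono interior_subset)).ne'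

/-- A Markov chain on a convex body whose transition probabilities dominate a multiple of
Lebesgue measure near the current state is positive recurrent to every ball. -/
theorem isPositiveRecurrentSet_closedBall (μ : Measure E) [μ.IsAddHaarMeasure]
    (hconv : Convex ℝ Θ) (hcpt : IsCompact Θ) (hint : (interior Θ).Nonempty)
    (P : Kernel Θ Θ) [IsMarkovKernel P] {s : ℝ} (hs : 0 < s) {c : ℝ≥0∞} (hc : 0 < c)
    (hmin : ∀ (θ : Θ) (A : Set Θ), MeasurableSet A → (∀ ψ ∈ A, ‖(ψ : E) - θ‖ ≤ s) →
      c * μ.comap Subtype.val A ≤ P θ A)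
    {θh : E} (hθh : θh ∈ Θ) {R : ℝ} (hR : 0 < R) :
    IsPositiveRecurrentSet P {θ : Θ | ‖(θ : E) - θh‖ ≤ R} := by
  obtain ⟨Δ, hΔ0, hΔ⟩ := exists_norm_sub_le hcpt
  have hΘm : MeasurableSet Θ := hcpt.isClosed.measurableSet
  -- From `θ` the target is the image of `B'` under the homothety of centre `θ` and ratio `t`:
  -- within reach `s`, inside `Θ`, and of volume independent of `θ`.
  set t := min 1 (s / Δ) with ht
  have ht0 : 0 < t := lt_min one_pos (by positivity)
  have ht1 : t ≤ 1 := min_le_left _ _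
  have htΔ : t * Δ ≤ s := by
    calc t * Δ ≤ s / Δ * Δ := by gcongr; exact min_le_right _ _
      _ = s := by field_simp
  have hballm : ∀ r : ℝ, MeasurableSet {θ : Θ | ‖(θ : E) - θh‖ ≤ r} := fun r =>
    measurableSet_le (by fun_prop) measurable_const
  set B' := Θ ∩ Metric.closedBall θh (R / 2) with hB'
  have hB'pos := measure_inter_closedBall_pos μ hconv hcpt hint hθh (half_pos hR)
  obtain ⟨k, hk⟩ : ∃ k : ℕ, (1 - t) ^ k < R / 2 / Δ :=
    exists_pow_lt_of_lt_one (by positivity) (by linarith)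
  -- The radii solve `D ↦ (1 - t) * D + t * (R / 2)`, the bound on the distance to `θh` after one
  -- such step. They tend to `R / 2`, so they drop below `R` in finitely many steps.
  refine isPositiveRecurrentSet_of_chain P (hballm R)
    (fun j => {θ : Θ | ‖(θ : E) - θh‖ ≤ (1 - t) ^ j * Δ + R / 2}) (fun j => hballm _) (k := k)
    ?_ ?_ (ε := c * (ENNReal.ofReal |t ^ Module.finrank ℝ E| * μ B')) ?_ ?_
  · refine eq_univ_of_forall fun θ => ?_
    change ‖(θ : E) - θh‖ ≤ (1 - t) ^ 0 * Δ + R / 2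
    rw [pow_zero, one_mul]
    linarith [hΔ θ θ.2 θh hθh]
  · intro θ hθ
    have h1 : ‖(θ : E) - θh‖ ≤ (1 - t) ^ k * Δ + R / 2 := hθ
    have h2 := (lt_div_iff₀ hΔ0).1 hk
    change ‖(θ : E) - θh‖ ≤ R
    linarith
  · exact ENNReal.mul_pos hc.ne' (ENNReal.mul_pos (by simp [ht0.ne']) hB'pos.ne').ne'
  · intro j θ hθ
    have hθ' : ‖(θ : E) - θh‖ ≤ (1 - t) ^ j * Δ + R / 2 := hθ
    set A : Set Θ := Subtype.val ⁻¹' (AffineMap.homothety (θ : E) t '' B') with hA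
    have hAm : MeasurableSet A := by
      refine measurable_subtype_coe ?_
      exact ((hcpt.inter_right Metric.isClosed_closedBall).image
        (AffineMap.homothety (θ : E) t).continuous_of_finiteDimensional).isClosed.measurableSet
    have himg : Subtype.val '' A = AffineMap.homothety (θ : E) t '' B' := by
      rw [hA, Subtype.image_preimage_coe, inter_eq_right]
      rintro _ ⟨ψ, hψ, rfl⟩
      exact homothety_mem hconv θ.2 hψ.1 ht0.le ht1
    have hAs : ∀ ψ ∈ A, ‖(ψ : E) - θ‖ ≤ s := by
      rintro ψ ⟨b, hb, hψ⟩
      rw [← hψ, AffineMap.homothety_apply]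
      simp only [vsub_eq_sub, vadd_eq_add, add_sub_cancel_right, norm_smul, Real.norm_eq_abs,
        abs_of_pos ht0]
      exact le_trans (by gcongr; exact hΔ _ hb.1 _ θ.2) htΔ
    have hAF : A ⊆ {θ : Θ | ‖(θ : E) - θh‖ ≤ (1 - t) ^ (j + 1) * Δ + R / 2} := by
      rintro ψ ⟨b, hb, hψ⟩
      have hb2 := mem_closedBall_iff_norm.1 hb.2
      change ‖(ψ : E) - θh‖ ≤ _
      have e : (ψ : E) - θh = (1 - t) • ((θ : E) - θh) + t • (b - θh) := by
        rw [← hψ, AffineMap.homothety_apply, vsub_eq_sub, vadd_eq_add]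
        module
      rw [e]
      calc _ ≤ ‖(1 - t) • ((θ : E) - θh)‖ + ‖t • (b - θh)‖ := norm_add_le _ _
        _ = (1 - t) * ‖(θ : E) - θh‖ + t * ‖b - θh‖ := by
            rw [norm_smul, norm_smul, Real.norm_of_nonneg ht0.le,
              Real.norm_of_nonneg (sub_nonneg.2 ht1)]
        _ ≤ (1 - t) * ((1 - t) ^ j * Δ + R / 2) + t * (R / 2) := by
            have := sub_nonneg.2 ht1
            gcongr
        _ = _ := by ring
    calc _ = c * μ.comap Subtype.val A := by
          rw [(MeasurableEmbedding.subtype_coe hΘm).comap_apply, himg,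
            Measure.addHaar_image_homothety]
      _ ≤ P θ A := hmin θ A hAm hAs
      _ ≤ _ := measure_mono hAF

/-- Points of the ball are at mutual distance at most `2R ≤ s`, so from each of them the
minorization covers the whole ball; normalized Lebesgue measure on it serves as `q`. -/
theorem isSmallSet_closedBall (μ : Measure E) [μ.IsAddHaarMeasure]
    (hconv : Convex ℝ Θ) (hcpt : IsCompact Θ) (hint : (interior Θ).Nonempty)
    (P : Kernel Θ Θ) [IsMarkovKernel P] {s : ℝ} {c : ℝ≥0∞} (hc : 0 < c)
    (hmin : ∀ (θ : Θ) (A : Set Θ), MeasurableSet A → (∀ ψ ∈ A, ‖(ψ : E) - θ‖ ≤ s) →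
      c * μ.comap Subtype.val A ≤ P θ A)
    {θh : E} (hθh : θh ∈ Θ) {R : ℝ} (hR : 0 < R) (hRs : R + R ≤ s) :
    IsSmallSet P {θ : Θ | ‖(θ : E) - θh‖ ≤ R} := by
  have hΘm : MeasurableSet Θ := hcpt.isClosed.measurableSet
  have hs : 0 < s := by linarith
  set B : Set Θ := {θ : Θ | ‖(θ : E) - θh‖ ≤ R} with hB
  have hBm : MeasurableSet B := measurableSet_le (by fun_prop) measurable_const
  set ν := μ.comap (Subtype.val : Θ → E) with hν
  have hνB : ν B = μ (Θ ∩ Metric.closedBall θh R) := by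
    rw [hν, (MeasurableEmbedding.subtype_coe hΘm).comap_apply]
    congr 1
    ext θ
    simp [hB, and_comm, dist_eq_norm]
  have hpos : 0 < ν B := hνB ▸ measure_inter_closedBall_pos μ hconv hcpt hint hθh hR
  have htop : ν B ≠ ⊤ := by
    rw [hνB]
    exact ne_top_of_le_ne_top hcpt.measure_lt_top.ne (measure_mono inter_subset_left)
  have hle : ∀ z ∈ B, ∀ A, MeasurableSet A → c * ν (B ∩ A) ≤ P z A := by
    intro z hz A hA
    refine (hmin z _ (hBm.inter hA) fun ψ hψ => ?_).trans (measure_mono inter_subset_right)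
    have h1 : ‖(ψ : E) - θh‖ ≤ R := hψ.1
    have h2 : ‖(z : E) - θh‖ ≤ R := hz
    calc ‖(ψ : E) - z‖ = ‖((ψ : E) - θh) - ((z : E) - θh)‖ := by congr 1; abel
      _ ≤ _ := norm_sub_le _ _
      _ ≤ s := by linarith
  have hθB : (⟨θh, hθh⟩ : Θ) ∈ B := by simp [hB, hR.le]
  -- The constant `c` is not assumed finite; the product is, being bounded by a transition
  -- probability.
  have hctop : c * ν B ≠ ⊤ := by
    have := hle _ hθB univ .univ
    rw [inter_univ] at this
    exact ne_top_of_le_ne_top (measure_ne_top _ _) this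
  refine ⟨(isPositiveRecurrentSet_closedBall μ hconv hcpt hint P hs hc hmin hθh
    hR).isAccessibleSet, (c * ν B).toNNReal, cond ν B, ?_, ?_, ?_⟩
  · exact ENNReal.toNNReal_pos (ENNReal.mul_pos hc.ne' hpos.ne').ne' hctop
  · exact cond_isProbabilityMeasure_of_finite hpos.ne' htop
  · intro z hz A hA
    rw [ENNReal.coe_toNNReal hctop, cond_apply hBm]
    calc c * ν B * ((ν B)⁻¹ * ν (B ∩ A)) = c * (ν B * (ν B)⁻¹) * ν (B ∩ A) := by ring
      _ = c * ν (B ∩ A) := by rw [ENNReal.mul_inv_cancel hpos.ne' htop, mul_one]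
      _ ≤ P z A := hle z hz A hA

end ConvexState

end MarkovChain

/-! ### The constants: positivity and decay of the radius -/

namespace ContrastiveDivergence.Model

variable {p d : ℕ} (M : Model p d)

theorem nonempty_X : Nonempty M.X := by
  by_contra h
  rw [not_nonempty_iff] at h
  exact M.carrier_ne_zero (lintegral_of_isEmpty _ _)

theorem abs_Sig_le {C : ℝ} (h1 : M.A1 C) (θ : EuclideanSpace ℝ (Fin d)) (i j : Fin d) :
    |M.Sig θ i j| ≤ 2 * C * (2 * C) := by
  have := M.isProbabilityMeasure_P h1 θ
  have hb : ∀ i x, |M.φ x i - ∫ y, M.φ y i ∂(M.P θ)| ≤ 2 * C := by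
    intro i x
    have h : |∫ y, M.φ y i ∂(M.P θ)| ≤ C := by
      simpa using norm_integral_le_of_norm_le_const (μ := M.P θ) (f := fun y => M.φ y i)
        (.of_forall fun y => h1 y i)
    have := abs_sub (M.φ x i) (∫ y, M.φ y i ∂(M.P θ))
    linarith [h1 x i]
  change |cov[fun x => M.φ x i, fun x => M.φ x j; M.P θ]| ≤ _
  rw [covariance]
  have := norm_integral_le_of_norm_le_const (μ := M.P θ) (C := 2 * C * (2 * C))
    (f := fun x => (M.φ x i - ∫ y, M.φ y i ∂(M.P θ)) * (M.φ x j - ∫ y, M.φ y j ∂(M.P θ)))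
    (.of_forall fun x => by
      rw [Real.norm_eq_abs, abs_mul]
      exact mul_le_mul (hb i x) (hb j x) (abs_nonneg _) ((abs_nonneg _).trans (hb i x)))
  simpa only [probReal_univ, mul_one, Real.norm_eq_abs] using this

/-- Gershgorin's theorem with the entry bound. Uniformity in `θ` makes `lamMax` a genuine supremum,
not the default value zero. -/
theorem le_of_mem_spectrum_Sig {C : ℝ} (h1 : M.A1 C) (θ : EuclideanSpace ℝ (Fin d)) {l : ℝ}
    (hl : l ∈ spectrum ℝ (M.Sig θ)) : l ≤ d * (2 * C * (2 * C)) := by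
  rw [← Matrix.spectrum_toLin', ← Module.End.hasEigenvalue_iff_mem_spectrum] at hl
  obtain ⟨k, hk⟩ := eigenvalue_mem_ball hl
  rw [mem_closedBall_iff_norm] at hk
  calc l ≤ ‖M.Sig θ k k‖ + ∑ j ∈ Finset.univ.erase k, ‖M.Sig θ k j‖ := by
        have h2 := le_abs_self (l - M.Sig θ k k)
        have h3 := le_abs_self (M.Sig θ k k)
        simp only [Real.norm_eq_abs] at hk ⊢
        linarith
    _ = ∑ j, ‖M.Sig θ k j‖ := Finset.add_sum_erase _ (fun j => ‖M.Sig θ k j‖) (Finset.mem_univ k)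
    _ ≤ ∑ _j : Fin d, 2 * C * (2 * C) := Finset.sum_le_sum fun j _ => M.abs_Sig_le h1 θ k j
    _ = _ := by simp

theorem lamMax_pos {C : ℝ} (h1 : M.A1 C) (h3 : M.A3) (hd : d ≠ 0)
    {θ : EuclideanSpace ℝ (Fin d)} (hθ : θ ∈ M.Θ) : 0 < M.lamMax := by
  have hbdd : BddAbove (range fun θ : M.Θ => sSup (spectrum ℝ (M.Sig θ))) := by
    refine ⟨d * (2 * C * (2 * C)), ?_⟩
    rintro _ ⟨ψ, rfl⟩
    exact Real.sSup_le (fun l hl => M.le_of_mem_spectrum_Sig h1 ψ hl)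
      (mul_nonneg (by positivity) (mul_self_nonneg _))
  refine lt_of_lt_of_le ?_ (le_ciSup hbdd ⟨θ, hθ⟩)
  have hpd := h3 θ hθ
  let i : Fin d := ⟨0, Nat.pos_of_ne_zero hd⟩
  refine lt_of_lt_of_le (hpd.eigenvalues_pos i) (le_csSup ?_ ?_)
  · exact ⟨_, fun l hl => M.le_of_mem_spectrum_Sig h1 θ hl⟩
  · exact hpd.1.eigenvalues_mem_spectrum_real i

/-- In dimension zero the spectra are empty, so both extremal eigenvalues take the default value
zero and `a = 0`. -/
theorem dim_ne_zero_of_aConst_pos {C L η : ℝ} {m : ℕ} (ha : 0 < M.aConst C L m η) : d ≠ 0 := by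
  rintro rfl
  have hmin : M.lamMin = 0 := by
    simp [lamMin, spectrum.of_subsingleton]
  have hmax : M.lamMax = 0 := by
    simp [lamMax, spectrum.of_subsingleton]
  simp [aConst, hmin, hmax] at ha

theorem rConst_pos {C γ η : ℝ} {L : ℝ≥0} {m n : ℕ} (h1 : M.A1 C) (h3 : M.A3)
    {θ : EuclideanSpace ℝ (Fin d)} (hθ : θ ∈ M.Θ) (hη : 0 < η) (ha : 0 < M.aConst C L m η)
    (hn : n ≠ 0) : 0 < M.rConst C L γ m η n := by
  have hd := M.dim_ne_zero_of_aConst_pos ha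
  have hmax := M.lamMax_pos h1 h3 hd hθ
  obtain ⟨x⟩ := M.nonempty_X
  have hC : 0 ≤ C := (abs_nonneg _).trans (h1 x ⟨0, Nat.pos_of_ne_zero hd⟩)
  have hbias : 0 ≤ M.biasCoef C L m := by
    have : 0 ≤ M.alpha := ENNReal.toReal_nonneg
    unfold biasCoef
    positivity
  have hn' : (0 : ℝ) < n := by positivity
  have hb : 0 < M.bConst C L γ m η n := by
    unfold bConst
    positivity
  unfold rConst
  positivity

theorem tendsto_natCast_rpow_zero {y : ℝ} (hy : y < 0) :
    Filter.Tendsto (fun n : ℕ => (n : ℝ) ^ y) Filter.atTop (nhds 0) := by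
  have := (tendsto_rpow_neg_atTop (neg_pos.2 hy)).comp tendsto_natCast_atTop_atTop
  simpa [Function.comp_def] using this

theorem tendsto_rConst {C L γ η : ℝ} {m : ℕ} (hγ0 : 0 < γ) (hγ : γ < 1 / 2) :
    Filter.Tendsto (M.rConst C L γ m η) Filter.atTop (nhds 0) := by
  have hb : Filter.Tendsto (M.bConst C L γ m η) Filter.atTop (nhds 0) := by
    have := (tendsto_natCast_rpow_zero (y := -(1 / 2) + γ) (by linarith)).const_mul
      (M.lamMax * (1 + M.biasCoef C L m) * (1 + η * M.lamMax + η * M.biasCoef C L m))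
    rw [mul_zero] at this
    exact this
  have hc : Filter.Tendsto (M.cConst C L γ m η) Filter.atTop (nhds 0) := by
    have h := ((((tendsto_natCast_rpow_zero (y := -2 * γ) (by linarith)).const_mul
      (d * C ^ 2)).add_const ((1 + M.biasCoef C L m) ^ 2)).const_mul (η * M.lamMax / 2)).mul
      (tendsto_natCast_rpow_zero (y := -1 + 2 * γ) (by linarith))
    rw [mul_zero] at h
    exact h
  have h := (hb.add ((hb.pow 2).add (hc.const_mul (4 * M.aConst C L m η))).sqrt).div_const
    (2 * M.aConst C L m η)
  have h0 : (0 + √(0 ^ 2 + 4 * M.aConst C L m η * 0)) / (2 * M.aConst C L m η) = 0 := by simp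
  rw [h0] at h
  exact h

/-- Samples whose mean is close to `μ(θ*)` have their mean well inside the range of `φ`. -/
theorem exists_closedBall_meanφ_subset {C γ : ℝ} (h1 : M.A1 C) (h6 : M.A6)
    {θs : EuclideanSpace ℝ (Fin d)} (hθs : θs ∈ M.Θ) (hγ : γ < 1 / 2) :
    ∃ ρ : ℝ, 0 < ρ ∧ ∃ N : ℕ, N ≠ 0 ∧ ∀ n ≥ N, ∀ x : Fin n → M.X,
      ‖M.meanφ x - M.mu θs‖ < (n : ℝ) ^ (-(1 / 2) + γ) →
        Metric.closedBall (M.meanφ x) (2 * ρ) ⊆ range M.φ := by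
  obtain ⟨r, hr, hball⟩ := Metric.mem_nhds_iff.1
    (mem_interior_iff_mem_nhds.1 (M.mu_mem_interior_range h1 h6 ⟨θs, hθs⟩))
  have hev := (tendsto_natCast_rpow_zero (y := -(1 / 2) + γ) (by linarith)).eventually_lt_const
    (show (0 : ℝ) < r / 4 by positivity)
  obtain ⟨N, hN⟩ := Filter.eventually_atTop.1 hev
  -- A ball of radius `2 * (r / 4)` about a point within `r / 4` of `μ(θ*)` stays in the ball of
  -- radius `r`.
  refine ⟨r / 4, by positivity, N + 1, N.succ_ne_zero, fun n hn x hx => ?_⟩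
  refine Subset.trans (fun v hv => ?_) hball
  have h2 := hN n (by omega)
  rw [mem_closedBall_iff_norm] at hv
  rw [mem_ball_iff_norm]
  calc ‖v - M.mu θs‖ = ‖(v - M.meanφ x) + (M.meanφ x - M.mu θs)‖ := by congr 1; abel
    _ ≤ _ := norm_add_le _ _
    _ < r := by linarith

end ContrastiveDivergence.Model

/-! ### The main theorem -/

theorem mainTheorem2 {p d : ℕ} (M : ContrastiveDivergence.Model p d) (C : ℝ)
    (θs : EuclideanSpace ℝ (Fin d)) (L : ℝ≥0) (γ : ℝ) (hγ0 : 0 < γ) (hγ : γ < 1 / 2)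
    (h1 : M.A1 C) (h2 : M.A2 θs) (h3 : M.A3) (h4 : M.A4) (h5 : M.A5) (h6 : M.A6)
    (hL : LipschitzOnWith L (M.chi θs) M.Θ) :
    (∃ N : ℕ, ∀ n ≥ N, ∀ (m : ℕ) (η : ℝ), 1 ≤ m → 0 < η → 0 < M.aConst C L m η →
      ∀ (x : Fin n → M.X) (θh : EuclideanSpace ℝ (Fin d)), M.IsMLE x θh → M.DataOK γ m θs θh x →
      ∀ R : M.BoundaryRule,
        MarkovChain.IsPositiveHarrisRecurrent (M.cdKernel m η x R) ∧
        ∀ β : ℝ, 1 < β →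
          MarkovChain.IsPositiveRecurrentSet (M.cdKernel m η x R) (M.ball C L γ m η n β θh)) ∧
    (∀ (m : ℕ) (η β : ℝ), 1 ≤ m → 0 < η → 0 < M.aConst C L m η → 1 < β →
      ∃ N : ℕ, ∀ n ≥ N, ∀ (x : Fin n → M.X) (θh : EuclideanSpace ℝ (Fin d)), M.IsMLE x θh →
      M.DataOK γ m θs θh x →
      ∀ R : M.BoundaryRule,
        MarkovChain.IsSmallSet (M.cdKernel m η x R) (M.ball C L γ m η n β θh)) := by
  obtain ⟨hconv, hcpt, hθs⟩ := h2
  have hθsΘ : θs ∈ M.Θ := interior_subset hθs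
  have hint : (interior M.Θ).Nonempty := ⟨θs, hθs⟩
  -- `ρ` and `N` are fixed before `m` and `η`, which gives the uniformity in the first claim.
  obtain ⟨ρ, hρ, N, hN0, hN⟩ := M.exists_closedBall_meanφ_subset (γ := γ) h1 h6 hθsΘ hγ
  refine ⟨⟨N, fun n hn m η hm hη ha x θh hmle hdata R => ?_⟩, fun m η β hm hη ha hβ => ?_⟩
  · have hn0 : n ≠ 0 := by omega
    obtain ⟨c, hc, hmin⟩ := M.exists_cdKernel_minorization hcpt h4 h6 (by omega : m ≠ 0) hn0 hη x
      hρ (hN n hn x hdata.1) R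
    have hs : 0 < η * ρ := mul_pos hη hρ
    have hrec := fun (r : ℝ) (hr : 0 < r) => MarkovChain.isPositiveRecurrentSet_closedBall volume
      hconv hcpt hint (M.cdKernel m η x R) hs hc hmin hmle.1 hr
    -- The Harris set is the ball of radius `η * ρ / 2`, the largest the smallness criterion allows;
    -- it need not be one of the `B_β`.
    refine ⟨⟨_, hrec (η * ρ / 2) (by positivity), MarkovChain.isSmallSet_closedBall volume
      hconv hcpt hint (M.cdKernel m η x R) hc hmin hmle.1 (by positivity) (by linarith)⟩,
      fun β hβ => hrec _ ?_⟩
    exact mul_pos (by linarith) (M.rConst_pos h1 h3 hθsΘ hη ha hn0)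
  · have hs : 0 < η * ρ := mul_pos hη hρ
    -- Smallness of `B_β` needs `β * r_n` at most `η * ρ / 2`, so here the threshold on `n` depends
    -- on `m`, `η` and `β`.
    have hev := ((M.tendsto_rConst (C := C) (L := L) (η := η) (m := m) hγ0 hγ).const_mul
      β).eventually_lt_const (show β * 0 < η * ρ / 2 by simpa using half_pos hs)
    obtain ⟨N', hN'⟩ := Filter.eventually_atTop.1 hev
    refine ⟨max N N', fun n hn x θh hmle hdata R => ?_⟩
    have hnN : N ≤ n := (le_max_left _ _).trans hn
    have hn0 : n ≠ 0 := by omega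
    obtain ⟨c, hc, hmin⟩ := M.exists_cdKernel_minorization hcpt h4 h6 (by omega : m ≠ 0) hn0 hη x
      hρ (hN n hnN x hdata.1) R
    have hr := hN' n ((le_max_right _ _).trans hn)
    exact MarkovChain.isSmallSet_closedBall volume hconv hcpt hint (M.cdKernel m η x R) hc hmin
      hmle.1 (mul_pos (by linarith) (M.rConst_pos h1 h3 hθsΘ hη ha hn0)) (by linarith)
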